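/- **Weighted causal diagrams.** A weighted causal diagram on a finite set of variables is a real matrix $K$, where $K_{ij}$ is the weight of the edge $j\to i$ (an edge exists iff $K_{ij}\ne0$); it is assumed acyclic. $Pa,Ch,An,De$ denote parents, children, ancestors and descendants ($v\notin An(v)$, $v\notin De(v)$). The total causal effect of $i$ on $j$ is the sum, over the directed paths from $i$ to $j$, of the products of the edge weights (and is $1$ for $i=j$). $TE(S,v)$ is the vector of total effects of the elements of $S$ on $v$, and $TC(v,S)$ the vector of total effects of $v$ on the elements of $S$. **SEM-ME.** A canonical linear SEM-ME on a finite set $V=\mathcal Z\sqcup\mathcal Y$ of (labelled) underlying variables consists of a weighted causal diagram $K$ on $V$ and a set $\mathcal Y\subseteq V$ of observed variables; the variables of $\mathcal Z$ are seen only through noisy measurements. A u-leaf node is an element of $\mathcal Z$ without children; the other variables are nu-leaf nodes. The model is $V=KV+N$, where exactly the nu-leaf nodes have an exogenous noise term, and $W^{ME}$ consists of the columns of $(I-K)^{-1}$ that belong to the nu-leaf nodes. The possible parents of $v$ are the ancestors of $v$ and the u-leaf nodes $\ne v$ all of whose parents are ancestors of $v$. *SEM-ME faithfulness*: (a) the total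 effect of a variable on each of its descendants is nonzero; (b1) for every $v$, $TE(An(v),v)$ is not a linear combination of $k\le|Pa(v)|$ of the vectors $TE(An(v),w)$, $w$ a possible parent of $v$, except when $k=|Pa(v)|$ and $Pa(l)\subseteq Pa(v)$ for every u-leaf node $l$ among the $k$ variables; (b2) for every u-leaf node $u$ and $v\in Pa(u)$, $TE(An(u)\setminus\{v\},u)$ is not a linear combination of $k\le|Pa(v)\cup Pa(u)|-1$ of the vectors $TE(An(u)\setminus\{v\},w)$, $w$ a possible parent of $v$, except when $k=|Pa(v)\cup Pa(u)|-1$ and $Pa(l)\subseteq Pa(v)\cup Pa(u)$ for every u-leaf node $l$ among the $k$ variables. *Condition 1* for an edge from a nu-leaf node $v$ to a u-leaf node $l$: $Pa(l)\setminus\{v\}\not\subseteq Pa(v)$, or $Pa(l)\not\subseteq Pa(k)$ for some $k\in Ch(v)\setminus\{l\}$. The *direct ordered grouping* (DOG) is the partition of $V$ in which each nu-leaf node $v$ forms a group together with the u-leaf nodes $l$ such that the edge $v\to l$ exists and violates Condition 1, and all remaining u-leaf nodes form one-element groups. **SEM-UR.** A linear SEM-UR with finite sets $\mathcal X$ of observed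 and $\mathcal H$ of latent variables is $X=BH+AX+N_X$, $H=N_H$, with the diagram of $A$ acyclic; its diagram on $\mathcal H\sqcup\mathcal X$ has the weights $A$ and $B$, and $W^{UR}=[(I-A)^{-1}B,\ (I-A)^{-1}]$. The possible children of $v$ are the descendants of $v$ and the latent variables $\ne v$ all of whose children are descendants of $v$. *SEM-UR faithfulness* is: (a) as above; (b1) for every $v$, $TC(v,De(v))$ is not a linear combination of $k\le|Ch(v)|$ of the vectors $TC(w,De(v))$, $w$ a possible child of $v$, except when $k=|Ch(v)|$ and $Ch(l)\subseteq Ch(v)$ for every latent $l$ among the $k$ variables; (b2) for every latent $h$ and $x\in Ch(h)$, $TC(h,De(h)\setminus\{x\})$ is not a linear combination of $k\le|Ch(x)\cup Ch(h)|-1$ of the vectors $TC(w,De(h)\setminus\{x\})$, $w$ a possible child of $x$, except when $k=|Ch(x)\cup Ch(h)|-1$ and $Ch(l)\subseteq Ch(x)\cup Ch(h)$ for every latent $l$ among the $k$ variables. *Condition 2* for an edge from a latent $h$ to an observed $x$: $Ch(h)\setminus\{x\}\not\subseteq Ch(x)$, or $Ch(h)\not\subseteq Ch(k)$ for some $k\in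 Pa(x)\setminus\{h\}$. The DOG is the partition of $\mathcal H\sqcup\mathcal X$ in which each observed $x$ forms a group together with the latent $h$ such that the edge $h\to x$ exists and violates Condition 2, and all remaining latent variables form one-element groups. **Equivalence and identifiability.** Separability means that the data determine the mixing matrix ($W^{ME}$ resp. $W^{UR}$) up to permutation and nonzero scaling of its columns, so models are to be identified from the mixing matrix up to this ambiguity. For a SEM-UR separability requires moreover that no two columns of $W^{UR}$ are linearly dependent, which is assumed (a SEM-ME needs no such assumption). The DOG equivalence class of a model consists of all faithful models on the same variables with the same mixing matrix, up to permutation and scaling of its columns, and the same DOG. A SEM-ME is *uniquely identifiable* if every faithful SEM-ME on $V$ with the same mixing matrix (up to permutation and scaling of columns) has the same weighted causal diagram. A SEM-UR is *identifiable up to permutation and scaling of the columns of $B$* if every faithful SEM-UR with the same mixing matrix (up to permutation and scaling of columns) has the same $A$ and, up to permutation and nonzero scaling of columns, the same $B$. **Corollary.** Let $M$ be a SEM-ME satisfying SEM-ME faithfulness. 1. The number of weighted causal diagrams of the models in the DOG equivalence class of $M$ is the product of the sizes of the direct ordered groups of $M$. 2. $M$ is uniquely identifiable if and only if every edge from a nu-leaf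 node to a u-leaf node satisfies Condition 1. 3. If it is moreover known which underlying variables are observed, i.e. only models with the same set $\mathcal Y$ as $M$ are admitted, then the number of models in the class is the product of the sizes of those groups that contain no element of $\mathcal Y$, and $M$ is the only faithful model with its mixing matrix (up to permutation and scaling of columns) if and only if every edge from an unobserved nu-leaf node to a u-leaf node satisfies Condition 1. In particular, if $\mathcal Y=\emptyset$, the formulas of 1 and 2 hold in this sense. Let $M$ be a separable SEM-UR satisfying SEM-UR faithfulness. 4. The DOG equivalence class of $M$, with models counted up to permutation and scaling of the columns of $B$, has size equal to the product of the sizes of the direct ordered groups of $M$. 5. $M$ is identifiable up to permutation and scaling of the columns of $B$ if and only if every edge from a latent to an observed variable satisfies Condition 2. -/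

import Mathlib

open scoped Matrix

noncomputable section

/-! ## Weighted causal diagrams

A weighted causal diagram on a finite set `V` of variables is a matrix `K`, where `K i j` is the
weight of the edge from `j` to `i` (there is such an edge iff `K i j ≠ 0`); it is the coefficient of
`j` in the structural equation of `i`. -/

namespace Diagram

variable {V : Type*}

/-- There is an edge from `j` to `i`. -/
def Edge (K : Matrix V V ℝ) (j i : V) : Prop := K i j ≠ 0

/-- The variables can be arranged in a total order in which every edge points forward. -/
def HasCausalOrder (K : Matrix V V ℝ) : Prop :=
  ∃ r : V → ℕ, Function.Injective r ∧ ∀ j i, Edge K j i → r j < r i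

variable [Fintype V]

open Classical in
/-- Parents of `i`. -/
def pa (K : Matrix V V ℝ) (i : V) : Finset V := Finset.univ.filter fun j => Edge K j i

open Classical in
/-- Children of `i`. -/
def ch (K : Matrix V V ℝ) (i : V) : Finset V := Finset.univ.filter fun j => Edge K i j

open Classical in
/-- Ancestors of `i`: the variables with a directed path (of length at least one) to `i`. -/
def an (K : Matrix V V ℝ) (i : V) : Finset V :=
  Finset.univ.filter fun j => Relation.TransGen (Edge K) j i

open Classical in
/-- Descendants of `i`: the variables with a directed path (of length at least one) from `i`. -/
def de (K : Matrix V V ℝ) (i : V) : Finset V :=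
  Finset.univ.filter fun j => Relation.TransGen (Edge K) i j

/-- Total causal effect of `i` on `j`: the sum, over the directed paths from `i` to `j`, of the
products of the edge weights along the path.  The entry `(K ^ n) j i` is the contribution of the
walks with `n` edges; in an acyclic diagram every walk is a path and has fewer than `card V` edges.
The path of length `0` gives every variable the total effect `1` on itself. -/
def totalEffect [DecidableEq V] (K : Matrix V V ℝ) (i j : V) : ℝ :=
  ∑ n ∈ Finset.range (Fintype.card V), (K ^ n) j i

/-- The vector of total causal effects of the elements of `S` on `v`. -/
def TE [DecidableEq V] (K : Matrix V V ℝ) (S : Finset V) (v : V) : S → ℝ :=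
  fun w => totalEffect K w v

/-- The vector of total causal effects of `v` on the elements of `S`. -/
def TC [DecidableEq V] (K : Matrix V V ℝ) (v : V) (S : Finset V) : S → ℝ :=
  fun w => totalEffect K v w

end Diagram

open Diagram

/-! ## Linear structural equation models with measurement error -/

/-- A canonical linear SEM-ME with underlying variables `V`.  The variables in `observed` are the
observed underlying variables, each of the others is seen only through a noisy measurement.  The
underlying variables satisfy `V = coef * V + noise`, where exactly the nu-leaf nodes (see below)
have an exogenous noise term. -/
@[ext]
structure SEMME (V : Type*) where
  coef : Matrix V V ℝ
  observed : Set V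
  causalOrder : HasCausalOrder coef

namespace SEMME

variable {V : Type*}

/-- u-leaf nodes: unobserved underlying variables without children. -/
def ULeaf (M : SEMME V) (v : V) : Prop := v ∉ M.observed ∧ ∀ w, ¬ Edge M.coef v w

/-- nu-leaf nodes: all other underlying variables. -/
def NULeaf (M : SEMME V) (v : V) : Prop := ¬ M.ULeaf v

variable [Fintype V] [DecidableEq V]

/-- The mixing matrix `W^ME`, which expresses all underlying variables through the exogenous noise
terms of the nu-leaf nodes. -/
def mixing (M : SEMME V) : Matrix V {v // M.NULeaf v} ℝ :=
  ((1 - M.coef)⁻¹).submatrix id Subtype.val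

/-- `M` and `M'` have the same mixing matrix up to permutation and (nonzero) scaling of its
columns. -/
def SameMixing (M M' : SEMME V) : Prop :=
  ∃ (e : {v // M'.NULeaf v} ≃ {v // M.NULeaf v}) (t : {v // M'.NULeaf v} → ℝ),
    (∀ s, t s ≠ 0) ∧ ∀ v s, M'.mixing v s = t s * M.mixing v (e s)

open Classical in
/-- Possible parents of `v`: its ancestors, and the u-leaf nodes other than `v` itself all of whose
parents are ancestors of `v`. -/
def possiblePa (M : SEMME V) (v : V) : Finset V :=
  Finset.univ.filter fun w =>
    w ≠ v ∧ (w ∈ an M.coef v ∨ (M.ULeaf w ∧ pa M.coef w ⊆ an M.coef v))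

/-- Conventional faithfulness: no total causal effect on a descendant vanishes. -/
def FaithfulA (M : SEMME V) : Prop :=
  ∀ i j, i ∈ an M.coef j → totalEffect M.coef i j ≠ 0

/-- `TE(An(v), v)` is not a linear combination of `k ≤ |Pa(v)|` of the vectors `TE(An(v), w)`, `w` a
possible parent of `v`, unless `k = |Pa(v)|` and `Pa(l) ⊆ Pa(v)` for each u-leaf node `l` among the
`k` possible parents. -/
def FaithfulB1 (M : SEMME V) : Prop :=
  ∀ v, ∀ T ⊆ M.possiblePa v, T.card ≤ (pa M.coef v).card →
    TE M.coef (an M.coef v) v ∈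
      Submodule.span ℝ ((fun w => TE M.coef (an M.coef v) w) '' (T : Set V)) →
    T.card = (pa M.coef v).card ∧ ∀ l ∈ T, M.ULeaf l → pa M.coef l ⊆ pa M.coef v

/-- For each u-leaf node `u` and each parent `v` of `u`, `TE(An(u) \ {v}, u)` is not a linear
combination of `k ≤ |Pa(v) ∪ Pa(u)| - 1` of the vectors `TE(An(u) \ {v}, w)`, `w` a possible parent
of `v`, unless `k = |Pa(v) ∪ Pa(u)| - 1` and `Pa(l) ⊆ Pa(v) ∪ Pa(u)` for each u-leaf node `l` among
the `k` possible parents. -/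
def FaithfulB2 (M : SEMME V) : Prop :=
  ∀ u, M.ULeaf u → ∀ v ∈ pa M.coef u, ∀ T ⊆ M.possiblePa v,
    T.card + 1 ≤ (pa M.coef v ∪ pa M.coef u).card →
    TE M.coef (an M.coef u \ {v}) u ∈
      Submodule.span ℝ ((fun w => TE M.coef (an M.coef u \ {v}) w) '' (T : Set V)) →
    T.card + 1 = (pa M.coef v ∪ pa M.coef u).card ∧
      ∀ l ∈ T, M.ULeaf l → pa M.coef l ⊆ pa M.coef v ∪ pa M.coef u

/-- SEM-ME faithfulness. -/
def Faithful (M : SEMME V) : Prop := M.FaithfulA ∧ M.FaithfulB1 ∧ M.FaithfulB2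

/-- Edge identifiability for an edge from the nu-leaf node `v` to the u-leaf
node `l`. -/
def EdgeId (M : SEMME V) (v l : V) : Prop :=
  ¬ pa M.coef l \ {v} ⊆ pa M.coef v ∨
    ∃ k ∈ ch M.coef v \ {l}, ¬ pa M.coef l ⊆ pa M.coef k

open Classical in
/-- The direct ordered group of a nu-leaf node `v`: `v` itself and the u-leaf nodes `l` such that
there is an edge from `v` to `l` which violates edge identifiability. -/
def group (M : SEMME V) (v : V) : Finset V :=
  {v} ∪ Finset.univ.filter fun l => M.ULeaf l ∧ Edge M.coef v l ∧ ¬ M.EdgeId v l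

open Classical in
/-- The direct ordered grouping (DOG): the groups of the nu-leaf nodes, and a separate one-element
group for each u-leaf node that belongs to none of these. -/
def dog (M : SEMME V) : Finset (Finset V) :=
  (Finset.univ.filter M.NULeaf).image M.group ∪
    (Finset.univ.filter fun l =>
      M.ULeaf l ∧ ∀ v, M.NULeaf v → Edge M.coef v l → M.EdgeId v l).image ({·})

/-- The DOG equivalence class: the faithful models with the same mixing matrix (up to permutation
and scaling of its columns) and the same direct ordered groups. -/
def dogClass (M : SEMME V) : Set (SEMME V) :=
  {M' | M'.Faithful ∧ SameMixing M M' ∧ M'.dog = M.dog}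

/-- Unique identifiability from the mixing matrix: a faithful model with the same mixing matrix (up
to permutation and scaling of its columns) has the same weighted causal diagram. -/
def UniquelyIdentifiable (M : SEMME V) : Prop :=
  ∀ M' : SEMME V, M'.Faithful → SameMixing M M' → M'.coef = M.coef

/-- Unique identifiability when it is moreover known which underlying variables are observed. -/
def UniquelyIdentifiableKnownObs (M : SEMME V) : Prop :=
  ∀ M' : SEMME V, M'.Faithful → SameMixing M M' → M'.observed = M.observed → M' = M

end SEMME

/-! ## Linear structural equation models with unobserved roots -/

/-- A linear SEM-UR with observed variables `X` and latent variables `H`: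
`X = B * H + A * X + N_X`, `H = N_H`. -/
structure SEMUR (X H : Type*) where
  A : Matrix X X ℝ
  B : Matrix X H ℝ
  causalOrder : HasCausalOrder A

namespace SEMUR

variable {X H : Type*}

/-- The weighted causal diagram on `H ⊕ X`; latent variables have no parents. -/
def coef (M : SEMUR X H) : Matrix (H ⊕ X) (H ⊕ X) ℝ := Matrix.fromBlocks 0 0 M.B M.A

/-- Equality of models up to permutation and (nonzero) scaling of the columns of `B`. -/
def instSetoid (X H : Type*) : Setoid (SEMUR X H) where
  r M M' := M'.A = M.A ∧ ∃ (e : Equiv.Perm H) (t : H → ℝ),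
    (∀ h, t h ≠ 0) ∧ ∀ x h, M'.B x h = t h * M.B x (e h)
  iseqv :=
    { refl := fun M => ⟨rfl, Equiv.refl H, fun _ => 1, by simp, by simp⟩
      symm := by
        rintro M M' ⟨hA, e, t, ht, h⟩
        refine ⟨hA.symm, e.symm, fun k => (t (e.symm k))⁻¹, fun k => inv_ne_zero (ht _), ?_⟩
        intro x k
        rw [h, Equiv.apply_symm_apply, inv_mul_cancel_left₀ (ht _)]
      trans := by
        rintro M M' M'' ⟨hA, e, t, ht, h⟩ ⟨hA', e', t', ht', h'⟩
        refine ⟨hA'.trans hA, e'.trans e, fun k => t' k * t (e' k),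
          fun k => mul_ne_zero (ht' _) (ht _), ?_⟩
        intro x k
        rw [h', h, Equiv.trans_apply, mul_assoc] }

variable [Fintype X] [Fintype H] [DecidableEq X] [DecidableEq H]

/-- The mixing matrix `W^UR = [(I - A)⁻¹ B, (I - A)⁻¹]`, which expresses the observed variables
through the exogenous noise terms of all variables. -/
def mixing (M : SEMUR X H) : Matrix X (H ⊕ X) ℝ :=
  Matrix.fromCols ((1 - M.A)⁻¹ * M.B) (1 - M.A)⁻¹

/-- The requirement that separability puts on the mixing matrix: no two of its columns are
proportional (noise terms with proportional columns enter the observed variables only through one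
linear combination and cannot be separated). -/
def Separable (M : SEMUR X H) : Prop :=
  ∀ v w : H ⊕ X, v ≠ w → LinearIndependent ℝ ![M.mixing.col v, M.mixing.col w]

/-- `M` and `M'` have the same mixing matrix up to permutation and (nonzero) scaling of its
columns. -/
def SameMixing (M M' : SEMUR X H) : Prop :=
  ∃ (e : Equiv.Perm (H ⊕ X)) (t : H ⊕ X → ℝ),
    (∀ v, t v ≠ 0) ∧ ∀ x v, M'.mixing x v = t v * M.mixing x (e v)

open Classical in
/-- Possible children of `v`: its descendants, and the latent variables other than `v` itself all of
whose children are descendants of `v`. -/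
def possibleCh (M : SEMUR X H) (v : H ⊕ X) : Finset (H ⊕ X) :=
  Finset.univ.filter fun w =>
    w ≠ v ∧ (w ∈ de M.coef v ∨ ((∃ h, w = Sum.inl h) ∧ ch M.coef w ⊆ de M.coef v))

/-- Conventional faithfulness: no total causal effect on a descendant vanishes. -/
def FaithfulA (M : SEMUR X H) : Prop :=
  ∀ i j, j ∈ de M.coef i → totalEffect M.coef i j ≠ 0

/-- `TC(v, De(v))` is not a linear combination of `k ≤ |Ch(v)|` of the vectors `TC(w, De(v))`, `w` a
possible child of `v`, unless `k = |Ch(v)|` and `Ch(l) ⊆ Ch(v)` for each latent variable `l` among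
the `k` possible children. -/
def FaithfulB1 (M : SEMUR X H) : Prop :=
  ∀ v, ∀ T ⊆ M.possibleCh v, T.card ≤ (ch M.coef v).card →
    TC M.coef v (de M.coef v) ∈
      Submodule.span ℝ ((fun w => TC M.coef w (de M.coef v)) '' (T : Set (H ⊕ X))) →
    T.card = (ch M.coef v).card ∧
      ∀ l : H, Sum.inl l ∈ T → ch M.coef (Sum.inl l) ⊆ ch M.coef v

/-- For each latent variable `h` and each child `x` of `h`, `TC(h, De(h) \ {x})` is not a linear
combination of `k ≤ |Ch(x) ∪ Ch(h)| - 1` of the vectors `TC(w, De(h) \ {x})`, `w` a possible child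
of `x`, unless `k = |Ch(x) ∪ Ch(h)| - 1` and `Ch(l) ⊆ Ch(x) ∪ Ch(h)` for each latent variable `l`
among the `k` possible children. -/
def FaithfulB2 (M : SEMUR X H) : Prop :=
  ∀ h : H, ∀ x ∈ ch M.coef (Sum.inl h), ∀ T ⊆ M.possibleCh x,
    T.card + 1 ≤ (ch M.coef x ∪ ch M.coef (Sum.inl h)).card →
    TC M.coef (Sum.inl h) (de M.coef (Sum.inl h) \ {x}) ∈
      Submodule.span ℝ
        ((fun w => TC M.coef w (de M.coef (Sum.inl h) \ {x})) '' (T : Set (H ⊕ X))) →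
    T.card + 1 = (ch M.coef x ∪ ch M.coef (Sum.inl h)).card ∧
      ∀ l : H, Sum.inl l ∈ T →
        ch M.coef (Sum.inl l) ⊆ ch M.coef x ∪ ch M.coef (Sum.inl h)

/-- SEM-UR faithfulness. -/
def Faithful (M : SEMUR X H) : Prop := M.FaithfulA ∧ M.FaithfulB1 ∧ M.FaithfulB2

/-- Edge identifiability for an edge from the latent variable `h` to the observed
variable `x`. -/
def EdgeId (M : SEMUR X H) (h : H) (x : X) : Prop :=
  ¬ ch M.coef (Sum.inl h) \ {Sum.inr x} ⊆ ch M.coef (Sum.inr x) ∨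
    ∃ k ∈ pa M.coef (Sum.inr x) \ {Sum.inl h}, ¬ ch M.coef (Sum.inl h) ⊆ ch M.coef k

open Classical in
/-- The direct ordered group of an observed variable `x`: `x` itself and the latent variables `h`
such that there is an edge from `h` to `x` which violates edge identifiability. -/
def group (M : SEMUR X H) (x : X) : Finset (H ⊕ X) :=
  {Sum.inr x} ∪
    (Finset.univ.filter fun h : H => M.B x h ≠ 0 ∧ ¬ M.EdgeId h x).image Sum.inl

open Classical in
/-- The direct ordered grouping (DOG): the groups of the observed variables, and a separate
one-element group for each latent variable that belongs to none of these. -/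
def dog (M : SEMUR X H) : Finset (Finset (H ⊕ X)) :=
  Finset.univ.image M.group ∪
    (Finset.univ.filter fun h : H => ∀ x, M.B x h ≠ 0 → M.EdgeId h x).image fun h => {Sum.inl h}

/-- The DOG equivalence class: the faithful models with the same mixing matrix (up to permutation
and scaling of its columns) and the same direct ordered groups. -/
def dogClass (M : SEMUR X H) : Set (SEMUR X H) :=
  {M' | M'.Faithful ∧ SameMixing M M' ∧ M'.dog = M.dog}

/-- Identifiability from the mixing matrix up to permutation and scaling of the columns of `B`: a
faithful model with the same mixing matrix (up to permutation and scaling of its columns) has the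
same matrix `A`, and the same matrix `B` up to permutation and scaling of its columns. -/
def Identifiable (M : SEMUR X H) : Prop :=
  ∀ M' : SEMUR X H, M'.Faithful → SameMixing M M' → (instSetoid X H).r M M'

end SEMUR

end

/-!
# Counting the models with a given mixing matrix

Everything is expressed through the rows of the mixing matrix, `R v : ι → ℝ`, where `ι` indexes
the noise terms. A model attaches each noise term `i` to a variable `ν i`, and its structural
equations say that `R v`, without the noise term of `v` itself, is a combination of the rows of
the parents of `v`. Faithfulness translates into conditions on supports and spans of rows
(`RowFaithful`). Under these conditions, condition (b1) or (b2) also forces the nu-leaf nodes in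
an extremal representation to be parents (`mem_rowSpan_of_minimal`), so that its conclusion says
that all rows involved lie in the span of the rows of the parents. In this form it does not depend
on the names of the parents.

Suppose that two faithful models `ν`, `ν'` have the same rows. Each of them represents rows in the
way that the faithfulness of the other one restricts. Where `ν' i ≠ ν i`, the variable `ν' i` is a
u-leaf node of the first model, and the numbers of parents satisfy a cycle of inequalities, which
are therefore equalities. The equality cases of (b1) and (b2) then give equal spans, and it
follows that the edge from `ν i` to `ν' i` violates Condition 1
(`RowFaithful.exchangeable_of_ne`). So `ν' i` lies in the direct ordered group of `ν i`.

Conversely, let `c i` be any member of the group of `ν i`. The set of parents of any variable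
contains, with `ν i`, all parents of `c i`; therefore its rows span the same space before and
after the exchange of the `ν i` with the `c i` (`RowFaithful.rowSpan_choice`). This makes `c` a
faithful model, whose diagram is that of `ν` with the variables renamed by the exchange
(`RowFaithful.exchange`); the groups remain the same. Since groups are disjoint, the models in the
class correspond to the choices of one member from each group, and different choices give edges in
opposite directions.

Reversing the edges turns a SEM-UR into a SEM-ME whose u-leaf nodes are the latent variables, with
the transposed mixing matrix. The permutation of the columns then renames the variables, and the
choice `c` is where the observed variables go. Separability shows that different choices lead to
different matrices `A` (`SEMUR.eq_of_rel`).
-/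

/-! ### Rows, nodes and parents -/

namespace RowModel

open Submodule

variable {V ι : Type*}

/-- The span of the rows that belong to the nodes `ν i`, `i ∈ Q`. -/
def rowSpan (R : V → ι → ℝ) (ν : ι → V) (Q : Finset ι) : Submodule ℝ (ι → ℝ) :=
  span ℝ ((fun i => R (ν i)) '' (Q : Set ι))

open Classical in
/-- The contribution of the noise term of `v` itself to the row of `v`; it vanishes unless `v` is
one of the nodes `ν i`. -/
noncomputable def own (R : V → ι → ℝ) (ν : ι → V) (v : V) : ι → ℝ :=
  fun j => if ν j = v then R v j else 0

/-- `w` is a possible parent of `v`: a variable other than `v` whose row is supported on the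
ancestors of `v`. -/
def PossPa (R : V → ι → ℝ) (ν : ι → V) (v w : V) : Prop :=
  w ≠ v ∧ ∀ j, R w j ≠ 0 → R v j ≠ 0 ∧ ν j ≠ v

/-- The rows `R v` (the total effects of the noise terms, which are indexed by `ι`, on `v`) come
from a faithful model in which `ν i` is the variable with noise term `i` and `p v` is the set of the
indices of the parents of `v`.  The weights of the edges do not occur, since the rows determine
them.  The fields `indep` and `indep'` are the conditions (b1) and (b2), with the conclusion that all
rows of the representation lie in the span of the rows of the parents. -/
structure RowFaithful [DecidableEq ι] (R : V → ι → ℝ) (ν : ι → V) (p : V → Finset ι) : Prop where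
  inj : Function.Injective ν
  diag : ∀ i, R (ν i) i ≠ 0
  mem : ∀ v, R v - own R ν v ∈ rowSpan R ν (p v)
  acyclic : ∃ r : V → ℕ, ∀ v, ∀ i ∈ p v, r (ν i) < r v
  trans : ∀ v, ∀ i ∈ p v, ∀ j, R (ν i) j ≠ 0 → R v j ≠ 0
  indep : ∀ v (T : Finset V), (∀ w ∈ T, PossPa R ν v w) → T.card ≤ (p v).card →
    R v - own R ν v ∈ span ℝ (R '' (T : Set V)) →
    T.card = (p v).card ∧ ∀ w ∈ T, R w ∈ rowSpan R ν (p v)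
  indep' : ∀ u, (∀ i, ν i ≠ u) → ∀ x ∈ p u, ∀ T : Finset V, (∀ w ∈ T, PossPa R ν (ν x) w) →
    T.card + 1 ≤ (p (ν x) ∪ p u).card →
    R u - Pi.single x (R u x) ∈ span ℝ (R '' (T : Set V)) →
    T.card + 1 = (p (ν x) ∪ p u).card ∧ ∀ w ∈ T, R w ∈ rowSpan R ν (p (ν x) ∪ p u)

theorem apply_eq_zero_of_mem_span {R : V → ι → ℝ} {T : Set V} {x : ι → ℝ} {j : ι}
    (hx : x ∈ span ℝ (R '' T)) (hT : ∀ w ∈ T, R w j = 0) : x j = 0 := by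
  have : span ℝ (R '' T) ≤ LinearMap.ker (LinearMap.proj (R := ℝ) (φ := fun _ : ι => ℝ) j) := by
    rw [span_le]
    rintro _ ⟨w, hw, rfl⟩
    simpa using hT w hw
  simpa using this hx

theorem rowSpan_eq_span_image [DecidableEq V] (R : V → ι → ℝ) (ν : ι → V) (Q : Finset ι) :
    rowSpan R ν Q = span ℝ (R '' ((Q.image ν : Finset V) : Set V)) := by
  rw [rowSpan, Finset.coe_image, Set.image_image]

theorem mem_rowSpan {R : V → ι → ℝ} {ν : ι → V} {Q : Finset ι} {i : ι} (hi : i ∈ Q) :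
    R (ν i) ∈ rowSpan R ν Q :=
  subset_span ⟨i, hi, rfl⟩

theorem rowSpan_mono {R : V → ι → ℝ} {ν : ι → V} {Q Q' : Finset ι} (h : Q ⊆ Q') :
    rowSpan R ν Q ≤ rowSpan R ν Q' :=
  span_mono (Set.image_mono (by exact_mod_cast h))

theorem rowSpan_le {R : V → ι → ℝ} {ν : ι → V} {Q : Finset ι} {S : Submodule ℝ (ι → ℝ)} :
    rowSpan R ν Q ≤ S ↔ ∀ i ∈ Q, R (ν i) ∈ S := by
  rw [rowSpan, span_le]
  constructor
  · exact fun h i hi => h ⟨i, hi, rfl⟩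
  · rintro h _ ⟨i, hi, rfl⟩
    exact h i hi

theorem apply_eq_zero_of_mem_rowSpan {R : V → ι → ℝ} {ν : ι → V} {Q : Finset ι} {x : ι → ℝ}
    {j : ι} (hx : x ∈ rowSpan R ν Q) (hQ : ∀ i ∈ Q, R (ν i) j = 0) : x j = 0 :=
  apply_eq_zero_of_mem_span (R := fun i => R (ν i)) hx hQ

theorem own_of_notMem {R : V → ι → ℝ} {ν : ι → V} {v : V} (h : ∀ i, ν i ≠ v) : own R ν v = 0 := by
  ext j
  simp [own, h]

theorem own_congr {R : V → ι → ℝ} {ν ν' : ι → V} {v : V} (h : ∀ j, ν j = v ↔ ν' j = v) :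
    own R ν v = own R ν' v := by
  ext j
  by_cases hj : ν j = v
  · simp [own, hj, (h j).1 hj]
  · simp [own, hj, mt (h j).2 hj]

theorem own_node [DecidableEq ι] {R : V → ι → ℝ} {ν : ι → V} (hν : Function.Injective ν) (i : ι) :
    own R ν (ν i) = Pi.single i (R (ν i) i) := by
  ext j
  rcases eq_or_ne j i with rfl | h
  · simp [own]
  · simp [own, hν.eq_iff, h]

/-- The case of a possible parent of a variable with a noise term; the row of such a variable is
supported outside of `x`, so it is automatically different from `ν x`. -/
theorem possPa_node_iff {R : V → ι → ℝ} {ν : ι → V} (hν : Function.Injective ν)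
    (hd : ∀ i, R (ν i) i ≠ 0) {x : ι} {w : V} :
    PossPa R ν (ν x) w ↔ ∀ j, R w j ≠ 0 → R (ν x) j ≠ 0 ∧ j ≠ x := by
  constructor
  · exact fun h j hj => ⟨(h.2 j hj).1, fun e => (h.2 j hj).2 (by rw [e])⟩
  · refine fun h => ⟨?_, fun j hj => ⟨(h j hj).1, fun e => (h j hj).2 (hν e)⟩⟩
    rintro rfl
    exact (h x (hd x)).2 rfl

theorem possPa_of_notMem_iff {R : V → ι → ℝ} {ν : ι → V} {v w : V} (hv : ∀ i, ν i ≠ v) :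
    PossPa R ν v w ↔ w ≠ v ∧ ∀ j, R w j ≠ 0 → R v j ≠ 0 := by
  simp [PossPa, hv]

/-- The rows of the nodes form a basis, since they generate the noise terms. -/
theorem linearIndependent_nodes [Fintype ι] [DecidableEq ι] {R : V → ι → ℝ} {ν : ι → V}
    {p : V → Finset ι} (hν : Function.Injective ν) (hd : ∀ i, R (ν i) i ≠ 0)
    (hm : ∀ v, R v - own R ν v ∈ rowSpan R ν (p v)) : LinearIndependent ℝ fun i => R (ν i) := by
  refine linearIndependent_of_top_le_span_of_card_eq_finrank ?_ (by simp)
  rw [← (Pi.basisFun ℝ ι).span_eq, span_le]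
  rintro _ ⟨i, rfl⟩
  have h1 := hm (ν i)
  rw [own_node hν] at h1
  have h2 : rowSpan R ν (p (ν i)) ≤ span ℝ (Set.range fun i => R (ν i)) :=
    span_mono (Set.image_subset_range _ _)
  have h3 : Pi.single i (R (ν i) i) ∈ span ℝ (Set.range fun i => R (ν i)) := by
    simpa using sub_mem (subset_span (Set.mem_range_self i)) (h2 h1)
  have h4 := smul_mem _ (R (ν i) i)⁻¹ h3
  rw [← Pi.single_smul, smul_eq_mul, inv_mul_cancel₀ (hd i)] at h4
  simpa using h4

/-- If a vector in the span of the rows of the nodes in `Q` is represented by a minimal set `T` of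
rows, and the leaves in `T` lie in that span, then so do the nodes in `T`. -/
theorem mem_rowSpan_of_minimal [Fintype ι] [DecidableEq ι] [DecidableEq V] {R : V → ι → ℝ}
    {ν : ι → V} (hli : LinearIndependent ℝ fun i => R (ν i)) {Q : Finset ι} {y : ι → ℝ}
    (hy : y ∈ rowSpan R ν Q) {T : Finset V} (hyT : y ∈ span ℝ (R '' (T : Set V)))
    (hmin : ∀ w ∈ T, y ∉ span ℝ (R '' ((T.erase w : Finset V) : Set V)))
    (hleaf : ∀ w ∈ T, (∀ i, ν i ≠ w) → R w ∈ rowSpan R ν Q) : ∀ w ∈ T, R w ∈ rowSpan R ν Q := by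
  intro w hw
  by_cases hν : ∀ i, ν i ≠ w
  · exact hleaf w hw hν
  push Not at hν
  obtain ⟨a, rfl⟩ := hν
  by_contra hc
  have haQ : a ∉ Q := fun h => hc (mem_rowSpan h)
  have hQ : rowSpan R ν Q ≤ rowSpan R ν (Finset.univ.erase a) := rowSpan_mono fun i hi => by
    simpa using fun h : i = a => haQ (h ▸ hi)
  obtain ⟨c, rfl⟩ := (mem_span_image_finset_iff_exists_fun' ℝ).1 hyT
  have hsum := Finset.add_sum_erase T (fun w => c w • R w) hw
  have hca : c (ν a) ≠ 0 := by
    intro h0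
    apply hmin _ hw
    rw [← hsum]
    simp only [h0, zero_smul, zero_add]
    exact sum_mem fun w hw => smul_mem _ _ (subset_span ⟨w, hw, rfl⟩)
  have h1 : c (ν a) • R (ν a) ∈ rowSpan R ν (Finset.univ.erase a) := by
    rw [eq_sub_of_add_eq hsum]
    refine sub_mem (hQ hy) (sum_mem fun w hw => smul_mem _ _ ?_)
    obtain ⟨hwa, hw⟩ := Finset.mem_erase.1 hw
    by_cases hν : ∀ i, ν i ≠ w
    · exact hQ (hleaf w hw hν)
    · push Not at hν
      obtain ⟨b, rfl⟩ := hν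
      exact mem_rowSpan (by simpa using fun h : b = a => hwa (h ▸ rfl))
  have h2 : R (ν a) ∈ rowSpan R ν (Finset.univ.erase a) := by
    simpa [smul_smul, hca] using smul_mem _ (c (ν a))⁻¹ h1
  exact hli.notMem_span_image (s := ((Finset.univ.erase a : Finset ι) : Set ι)) (x := a)
    (by simp) h2

namespace RowFaithful

variable [DecidableEq ι] {R : V → ι → ℝ} {ν ν' : ι → V} {p p' : V → Finset ι}

/-- Faithfulness does not depend on the names of the variables. -/
theorem relabel {V' : Type*} (ρ : V' ≃ V) {ν : ι → V'} {p : V' → Finset ι}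
    (h : RowFaithful (fun v => R (ρ v)) ν p) :
    RowFaithful R (fun i => ρ (ν i)) fun v => p (ρ.symm v) := by
  have himg : ∀ T : Finset V,
      (fun v => R (ρ v)) '' ((T.map ρ.symm.toEmbedding : Finset V') : Set V') =
        R '' (T : Set V) := by
    intro T
    rw [← Set.image_image R ρ, Finset.coe_map, Equiv.coe_toEmbedding, ρ.image_symm_eq_preimage,
      Set.image_preimage_eq _ ρ.surjective]
  have hown : ∀ v, own R (fun i => ρ (ν i)) v = own (fun v => R (ρ v)) ν (ρ.symm v) := by
    intro v
    ext j
    by_cases hj : ρ (ν j) = v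
    · simp [own, (ρ.eq_symm_apply).2 hj]
    · simp [own, hj, mt (ρ.eq_symm_apply).1 hj]
  have hpp : ∀ v w, PossPa R (fun i => ρ (ν i)) v w →
      PossPa (fun v => R (ρ v)) ν (ρ.symm v) (ρ.symm w) := by
    intro v w
    simp [PossPa, Equiv.eq_symm_apply]
  refine ⟨ρ.injective.comp h.inj, h.diag, fun v => ?_, ?_, fun v i hi j hj => ?_, ?_, ?_⟩
  · have := h.mem (ρ.symm v)
    rwa [← hown, ρ.apply_symm_apply] at this
  · obtain ⟨r, hr⟩ := h.acyclic
    exact ⟨fun v => r (ρ.symm v), fun v i hi => by simpa using hr _ i hi⟩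
  · simpa using h.trans _ i hi j hj
  · intro v T hT hcard hm
    have key := h.indep (ρ.symm v) (T.map ρ.symm.toEmbedding) (by
      intro w hw
      obtain ⟨w, hw', rfl⟩ := Finset.mem_map.1 hw
      exact hpp v w (hT w hw'))
    rw [Finset.card_map, himg, ← hown, ρ.apply_symm_apply] at key
    refine ⟨(key hcard hm).1, fun w hw => ?_⟩
    have := (key hcard hm).2 (ρ.symm w) (Finset.mem_map_of_mem _ hw)
    rwa [ρ.apply_symm_apply] at this
  · intro u hu x hx T hT hcard hm
    have key := h.indep' (ρ.symm u) (fun i hi => hu i (by rw [hi, ρ.apply_symm_apply])) x hx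
      (T.map ρ.symm.toEmbedding) (by
        intro w hw
        obtain ⟨w, hw', rfl⟩ := Finset.mem_map.1 hw
        simpa using hpp _ w (hT w hw'))
    rw [Finset.card_map, himg, ρ.apply_symm_apply] at key
    simp only [ρ.symm_apply_apply] at hcard ⊢
    refine ⟨(key hcard hm).1, fun w hw => ?_⟩
    have := (key hcard hm).2 (ρ.symm w) (Finset.mem_map_of_mem _ hw)
    rwa [ρ.apply_symm_apply] at this

theorem eq_or_exists_parent (h : RowFaithful R ν p) {v : V} {j : ι} (hj : R v j ≠ 0) :
    ν j = v ∨ ∃ i ∈ p v, R (ν i) j ≠ 0 := by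
  by_contra! hc
  have := apply_eq_zero_of_mem_rowSpan (h.mem v) hc.2
  simp [own, hc.1, hj] at this

/-- The ancestor relation, read off from the supports of the rows, is transitive. -/
theorem support_trans (h : RowFaithful R ν p) {v : V} {i j : ι} (hi : R v i ≠ 0)
    (hj : R (ν i) j ≠ 0) : R v j ≠ 0 := by
  obtain ⟨r, hr⟩ := h.acyclic
  induction hn : r v using Nat.strong_induction_on generalizing v with
  | _ n ih =>
    rcases h.eq_or_exists_parent hi with rfl | ⟨a, ha, hai⟩
    · exact hj
    · exact h.trans v a ha j (ih _ (hn ▸ hr v a ha) hai rfl)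

theorem support_order (h : RowFaithful R ν p) :
    ∃ r : V → ℕ, (∀ v, ∀ i ∈ p v, r (ν i) < r v) ∧ ∀ v j, R v j ≠ 0 → ν j = v ∨ r (ν j) < r v := by
  obtain ⟨r, hr⟩ := h.acyclic
  refine ⟨r, hr, fun v j hj => ?_⟩
  induction hn : r v using Nat.strong_induction_on generalizing v with
  | _ n ih =>
    rcases h.eq_or_exists_parent hj with hv | ⟨a, ha, haj⟩
    · exact Or.inl hv
    · have := hr v a ha
      rcases ih _ (hn ▸ this) _ haj rfl with e | e
      · rw [e, ← hn]
        exact Or.inr this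
      · omega

theorem support_antisymm (h : RowFaithful R ν p) {i j : ι} (hij : R (ν i) j ≠ 0)
    (hji : R (ν j) i ≠ 0) : i = j := by
  obtain ⟨r, -, hr⟩ := h.support_order
  rcases hr _ _ hij with e | e
  · exact (h.inj e).symm
  · rcases hr _ _ hji with e' | e'
    · exact h.inj e'
    · omega

theorem support_parent (h : RowFaithful R ν p) {v : V} {i : ι} (hi : i ∈ p v) : R v i ≠ 0 :=
  h.trans v i hi i (h.diag i)

theorem possPa_parent (h : RowFaithful R ν p) {v : V} {i : ι} (hi : i ∈ p v) :
    PossPa R ν v (ν i) := by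
  obtain ⟨r, hr, hr'⟩ := h.support_order
  have h1 := hr v i hi
  refine ⟨fun e => by simp [e] at h1, fun j hj => ⟨h.trans v i hi j hj, ?_⟩⟩
  rintro rfl
  rcases hr' _ _ hj with e | e
  · simp [e] at h1
  · omega

theorem notMem_parents_self (h : RowFaithful R ν p) (i : ι) : i ∉ p (ν i) :=
  fun hi => (h.possPa_parent hi).1 rfl

/-- A variable `ν i` is a parent of `u` if it is a last ancestor of `u`. -/
theorem mem_parents_of_support_le (h : RowFaithful R ν p) {u : V} {i : ι} (hu : ∀ j, ν j ≠ u)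
    (hi : R u i ≠ 0) (hs : ∀ j, R u j ≠ 0 → R (ν i) j ≠ 0) : i ∈ p u := by
  rcases h.eq_or_exists_parent hi with e | ⟨a, ha, hai⟩
  · exact (hu i e).elim
  · rwa [← h.support_antisymm hai (hs a (h.support_parent ha))]

theorem apply_eq_zero_of_mem_parents (h : RowFaithful R ν p) {i j : ι} (hj : j ∈ p (ν i)) :
    R (ν j) i = 0 := by
  by_contra hc
  exact ((h.possPa_parent hj).2 i hc).2 rfl

theorem mem_rowSpan_sub_single (h : RowFaithful R ν p) (i : ι) :
    R (ν i) - Pi.single i (R (ν i) i) ∈ rowSpan R ν (p (ν i)) :=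
  own_node (R := R) h.inj i ▸ h.mem (ν i)

theorem mem_rowSpan_of_notMem (h : RowFaithful R ν p) {u : V} (hu : ∀ i, ν i ≠ u) :
    R u ∈ rowSpan R ν (p u) := by
  simpa [own_of_notMem hu] using h.mem u

variable [Fintype ι]

theorem linearIndependent (h : RowFaithful R ν p) : LinearIndependent ℝ fun i => R (ν i) :=
  linearIndependent_nodes h.inj h.diag h.mem

theorem mem_rowSpan_iff (h : RowFaithful R ν p) {i : ι} {Q : Finset ι} :
    R (ν i) ∈ rowSpan R ν Q ↔ i ∈ Q := by
  refine ⟨fun hi => ?_, mem_rowSpan⟩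
  by_contra hc
  exact h.linearIndependent.notMem_span_image (s := (Q : Set ι)) (x := i) (by simpa using hc) hi

/-- The weights of the edges into the variables, in the coordinates given by the rows. -/
theorem exists_weights (h : RowFaithful R ν p) :
    ∃ k : V → ι → ℝ, (∀ v i, k v i ≠ 0 ↔ i ∈ p v) ∧
      ∀ v, R v - own R ν v = ∑ i, k v i • R (ν i) := by
  classical
  have hex : ∀ v, ∃ k : ι → ℝ, (∀ i, k i ≠ 0 ↔ i ∈ p v) ∧
      R v - own R ν v = ∑ i, k i • R (ν i) := by
    intro v
    obtain ⟨c, hc⟩ := (mem_span_image_finset_iff_exists_fun' ℝ).1 (h.mem v)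
    refine ⟨fun i => if i ∈ p v then c i else 0, fun i => ?_, by simp [← hc]⟩
    by_cases hi : i ∈ p v
    · simp only [hi, if_true, iff_true]
      intro h0
      -- a parent with weight zero could be dropped, against faithfulness
      have h1 := h.indep v (((p v).erase i).image ν) (by
        intro w hw
        obtain ⟨j, hj, rfl⟩ := Finset.mem_image.1 hw
        exact h.possPa_parent (Finset.mem_of_mem_erase hj))
      rw [Finset.card_image_of_injective _ h.inj] at h1
      have h2 := (h1 (Finset.card_le_card (Finset.erase_subset _ _)) (by
        rw [← rowSpan_eq_span_image, ← hc, ← Finset.add_sum_erase _ _ hi, h0, zero_smul, zero_add]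
        exact sum_mem fun j hj => smul_mem _ _ (mem_rowSpan hj))).1
      rw [Finset.card_erase_of_mem hi] at h2
      have := Finset.card_pos.2 ⟨i, hi⟩
      omega
    · simp [hi]
  choose k hk using hex
  exact ⟨k, fun v => (hk v).1, fun v => (hk v).2⟩

/-- A variable without noise term lies in the span of a set of nodes only if its parents do. -/
theorem parents_subset_iff (h : RowFaithful R ν p) {u : V} (hu : ∀ i, ν i ≠ u) {Q : Finset ι} :
    R u ∈ rowSpan R ν Q ↔ p u ⊆ Q := by
  refine ⟨fun hm i hi => ?_, fun hs => rowSpan_mono hs (h.mem_rowSpan_of_notMem hu)⟩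
  obtain ⟨k, hk, he⟩ := h.exists_weights
  have h1 := he u
  rw [own_of_notMem hu, sub_zero, ← Finset.add_sum_erase _ _ (Finset.mem_univ i)] at h1
  by_contra hc
  -- otherwise the row of `ν i` would be a combination of the rows of the other nodes
  have h2 : R (ν i) ∈ rowSpan R ν (Finset.univ.erase i) := by
    have h3 : k u i • R (ν i) ∈ rowSpan R ν (Finset.univ.erase i) := by
      rw [eq_sub_of_add_eq h1.symm]
      refine sub_mem (rowSpan_mono (fun j hj => ?_) hm)
        (sum_mem fun j hj => smul_mem _ _ (mem_rowSpan hj))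
      simp only [Finset.mem_erase, Finset.mem_univ, and_true]
      rintro rfl
      exact hc hj
    simpa [smul_smul, inv_mul_cancel₀ ((hk u i).2 hi)] using smul_mem _ (k u i)⁻¹ h3
  exact absurd (h.mem_rowSpan_iff.1 h2) (by simp)

end RowFaithful

/-- The variable `s` without noise term can take over the noise term of its parent `ν i`: the other
parents of `s` are parents of `ν i`, and every child of `ν i` has all parents of `s`. -/
structure Exchangeable [DecidableEq ι] (ν : ι → V) (p : V → Finset ι) (i : ι) (s : V) : Prop where
  notMem : ∀ j, ν j ≠ s
  parent : i ∈ p s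
  subset : p s ⊆ insert i (p (ν i))
  closed : ∀ w, i ∈ p w → p s ⊆ p w

/-! ### Two faithful models with the same rows -/

namespace RowFaithful

variable [DecidableEq ι] {R : V → ι → ℝ} {ν ν' : ι → V} {p p' : V → Finset ι}

theorem support_node_iff (h : RowFaithful R ν p) (h' : RowFaithful R ν' p') (i j : ι) :
    R (ν i) j ≠ 0 ↔ R (ν' i) j ≠ 0 :=
  ⟨h.support_trans (h'.diag i), h'.support_trans (h.diag i)⟩

theorem possPa_node_congr (h : RowFaithful R ν p) (h' : RowFaithful R ν' p') {x : ι} {w : V} :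
    PossPa R ν (ν x) w ↔ PossPa R ν' (ν' x) w := by
  rw [possPa_node_iff h.inj h.diag, possPa_node_iff h'.inj h'.diag]
  simp only [h.support_node_iff h']

theorem notMem_range_of_ne (h : RowFaithful R ν p) (h' : RowFaithful R ν' p') {i : ι}
    (hi : ν' i ≠ ν i) (j : ι) : ν j ≠ ν' i := by
  intro e
  have h1 : R (ν j) i ≠ 0 := e ▸ h'.diag i
  have h2 : R (ν i) j ≠ 0 := (h.support_node_iff h' i j).2 (e ▸ h.diag j)
  exact hi (by rw [← e, h.support_antisymm h1 h2])

theorem mem_parents_of_ne (h : RowFaithful R ν p) (h' : RowFaithful R ν' p') {i : ι}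
    (hi : ν' i ≠ ν i) : i ∈ p (ν' i) :=
  h.mem_parents_of_support_le (h.notMem_range_of_ne h' hi) (h'.diag i)
    fun j hj => (h.support_node_iff h' i j).2 hj

/-- A variable that has the same noise term, or none, in both models. -/
theorem rowSpan_le_of_fixed (h : RowFaithful R ν p) (h' : RowFaithful R ν' p') {w : V}
    (hw : ∀ j, ν j = w ↔ ν' j = w) :
    (p w).card ≤ (p' w).card ∧
      ((p' w).card = (p w).card → rowSpan R ν' (p' w) ≤ rowSpan R ν (p w)) := by
  classical
  have hown : own R ν w = own R ν' w := own_congr hw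
  have key := h.indep w ((p' w).image ν') (by
    intro x hx
    obtain ⟨j, hj, rfl⟩ := Finset.mem_image.1 hx
    have := h'.possPa_parent hj
    simpa only [PossPa, ne_eq, hw] using this)
  rw [Finset.card_image_of_injective _ h'.inj, ← rowSpan_eq_span_image, hown] at key
  constructor
  · by_contra! hc
    exact absurd (key hc.le (h'.mem w)).1 hc.ne
  · intro e
    rw [rowSpan_le]
    exact fun i hi => (key e.le (h'.mem w)).2 _ (Finset.mem_image_of_mem _ hi)

/-- The parents of `ν' i` in the second model, together with those of `ν i`, represent the row of
`ν i` without its own noise term. -/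
theorem rowSpan_le_node (h : RowFaithful R ν p) (h' : RowFaithful R ν' p') {i : ι}
    (hi : ν' i ≠ ν i) (hc : (p' (ν i) ∪ p' (ν' i)).card = (p (ν i)).card + 1) :
    rowSpan R ν' (p' (ν' i)) ≤ rowSpan R ν (p (ν i)) := by
  classical
  have hmi : i ∈ p' (ν i) := h'.mem_parents_of_ne h hi.symm
  have hmi' : i ∉ p' (ν' i) := h'.notMem_parents_self i
  have hnr := h'.notMem_range_of_ne h hi.symm
  set Q := (p' (ν i)).erase i ∪ p' (ν' i) with hQ
  have hcard : Q.card + 1 = (p' (ν i) ∪ p' (ν' i)).card := by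
    have : Q = (p' (ν i) ∪ p' (ν' i)).erase i := by
      rw [Finset.erase_union_distrib, Finset.erase_eq_of_notMem hmi']
    rw [this, Finset.card_erase_of_mem (Finset.mem_union_left _ hmi)]
    have := Finset.card_pos.2 ⟨i, Finset.mem_union_left (p' (ν' i)) hmi⟩
    omega
  -- the supports of the rows in `Q` consist of proper ancestors of `ν i`
  have hpp : ∀ j ∈ Q, PossPa R ν (ν i) (ν' j) := by
    intro j hj
    have hle : ∀ l, R (ν' j) l ≠ 0 → R (ν i) l ≠ 0 := by
      rcases Finset.mem_union.1 hj with hj | hj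
      · exact h'.trans _ j (Finset.mem_of_mem_erase hj)
      · exact fun l hl => (h.support_node_iff h' i l).2 (h'.trans _ j hj l hl)
    have hne : j ≠ i := by
      rintro rfl
      rcases Finset.mem_union.1 hj with hj | hj
      · simp at hj
      · exact hmi' hj
    rw [possPa_node_iff h.inj h.diag]
    refine fun l hl => ⟨hle l hl, ?_⟩
    rintro rfl
    exact hne (h'.support_antisymm hl ((h.support_node_iff h' l j).1 (hle j (h'.diag j))))
  have hzero : ∀ j ∈ Q, R (ν' j) i = 0 := by
    intro j hj
    by_contra hc
    exact ((possPa_node_iff h.inj h.diag).1 (hpp j hj) i hc).2 rfl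
  have hmem : R (ν i) - own R ν (ν i) ∈ rowSpan R ν' Q := by
    have h1 := h'.mem_rowSpan_of_notMem hnr
    rw [rowSpan, ← Finset.insert_erase hmi, Finset.coe_insert, Set.image_insert_eq,
      mem_span_insert] at h1
    obtain ⟨a, z, hz, hR⟩ := h1
    have hz' : z ∈ rowSpan R ν' Q := rowSpan_mono Finset.subset_union_left hz
    have hs := rowSpan_mono (Q' := Q) Finset.subset_union_right (h'.mem_rowSpan_sub_single i)
    have hsum : R (ν i) - a • Pi.single i (R (ν' i) i) ∈ rowSpan R ν' Q := by
      convert add_mem hz' (smul_mem _ a hs) using 1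
      rw [hR, smul_sub]
      abel
    have h0 := apply_eq_zero_of_mem_rowSpan hsum hzero
    simp only [Pi.sub_apply, Pi.smul_apply, Pi.single_eq_same, smul_eq_mul] at h0
    rw [own_node h.inj, sub_eq_zero.1 h0, ← smul_eq_mul, Pi.single_smul]
    exact hsum
  have key := h.indep (ν i) (Q.image ν') (by
    intro x hx
    obtain ⟨j, hj, rfl⟩ := Finset.mem_image.1 hx
    exact hpp j hj)
  rw [Finset.card_image_of_injective _ h'.inj, ← rowSpan_eq_span_image] at key
  rw [rowSpan_le]
  exact fun j hj => (key (by omega) hmem).2 _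
    (Finset.mem_image_of_mem _ (Finset.mem_union_right _ hj))

/-- In the second model `ν' i` has the noise term `i`, and its parents represent its row without this
noise term, which (b2) restricts in the first model. -/
theorem card_union_le (h : RowFaithful R ν p) (h' : RowFaithful R ν' p') {i : ι}
    (hi : ν' i ≠ ν i) : (p (ν i) ∪ p (ν' i)).card ≤ (p' (ν' i)).card + 1 := by
  classical
  have key := h.indep' (ν' i) (h.notMem_range_of_ne h' hi) i (h.mem_parents_of_ne h' hi)
    ((p' (ν' i)).image ν') (by
      intro x hx
      obtain ⟨j, hj, rfl⟩ := Finset.mem_image.1 hx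
      exact (h.possPa_node_congr h').2 (h'.possPa_parent hj))
  rw [Finset.card_image_of_injective _ h'.inj, ← rowSpan_eq_span_image] at key
  by_contra! hc
  have := (key hc.le (h'.mem_rowSpan_sub_single i)).1
  omega

theorem rowSpan_eq_of_fixed (h : RowFaithful R ν p) (h' : RowFaithful R ν' p') {w : V}
    (hw : ∀ j, ν j = w ↔ ν' j = w) : rowSpan R ν' (p' w) = rowSpan R ν (p w) := by
  have h1 := h.rowSpan_le_of_fixed h' hw
  have h2 := h'.rowSpan_le_of_fixed h fun j => (hw j).symm
  exact le_antisymm (h1.2 (le_antisymm h2.1 h1.1)) (h2.2 (le_antisymm h1.1 h2.1))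

theorem card_lt_card_union (h : RowFaithful R ν p) (h' : RowFaithful R ν' p') {i : ι}
    (hi : ν' i ≠ ν i) : (p (ν i)).card < (p (ν i) ∪ p (ν' i)).card := by
  rw [Nat.lt_iff_add_one_le, ← Finset.card_insert_of_notMem (h.notMem_parents_self i)]
  exact Finset.card_le_card (Finset.insert_subset
    (Finset.mem_union_right _ (h.mem_parents_of_ne h' hi)) Finset.subset_union_left)

/-- The inequalities of `card_union_le` and `card_lt_card_union`, for the two models in either
order, form a cycle, so they are all sharp. -/
theorem card_union_eq (h : RowFaithful R ν p) (h' : RowFaithful R ν' p') {i : ι}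
    (hi : ν' i ≠ ν i) :
    (p (ν i) ∪ p (ν' i)).card = (p (ν i)).card + 1 ∧
      (p' (ν i) ∪ p' (ν' i)).card = (p (ν i)).card + 1 := by
  have h3 := h.card_union_le h' hi
  have h4 := h'.card_union_le h hi.symm
  have h5 := h.card_lt_card_union h' hi
  have h6 := h'.card_lt_card_union h hi.symm
  rw [Finset.union_comm] at h4 h6
  omega

theorem rowSpan_eq_of_ne_node (h : RowFaithful R ν p) (h' : RowFaithful R ν' p') {i : ι}
    (hi : ν' i ≠ ν i) : rowSpan R ν' (p' (ν' i)) = rowSpan R ν (p (ν i)) := by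
  have h1 := h.card_union_eq h' hi
  have h2 := h'.card_union_eq h hi.symm
  refine le_antisymm (h.rowSpan_le_node h' hi h1.2) (h'.rowSpan_le_node h hi.symm ?_)
  rw [Finset.union_comm, h1.1, ← h1.2, Finset.union_comm, h2.1]

variable [Fintype ι]

/-- In the second model `ν' i` is a parent of `ν i`, so that the row of `ν' i` is a combination of
the row of `ν i` and the rows of the other parents. -/
theorem rowSpan_le_leaf (h : RowFaithful R ν p) (h' : RowFaithful R ν' p') {i : ι}
    (hi : ν' i ≠ ν i) :
    (p (ν' i)).card ≤ (p' (ν i)).card ∧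
      ((p' (ν i)).card = (p (ν' i)).card →
        rowSpan R ν' (p' (ν i)) ≤ rowSpan R ν (p (ν' i))) := by
  classical
  have hmi : i ∈ p' (ν i) := h'.mem_parents_of_ne h hi.symm
  have hnr := h'.notMem_range_of_ne h hi.symm
  have hnr' := h.notMem_range_of_ne h' hi
  set T := insert (ν i) (((p' (ν i)).erase i).image ν') with hT
  have hcard : T.card = (p' (ν i)).card := by
    rw [hT, Finset.card_insert_of_notMem, Finset.card_image_of_injective _ h'.inj,
      Finset.card_erase_of_mem hmi]
    · have := Finset.card_pos.2 ⟨i, hmi⟩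
      omega
    · intro hm
      obtain ⟨j, -, hj⟩ := Finset.mem_image.1 hm
      exact hnr j hj
  have hpp : ∀ w ∈ T, PossPa R ν (ν' i) w := by
    intro w hw
    rw [possPa_of_notMem_iff hnr']
    rcases Finset.mem_insert.1 hw with rfl | hw
    · exact ⟨hi.symm, fun j hj => (h.support_node_iff h' i j).1 hj⟩
    · obtain ⟨j, hj, rfl⟩ := Finset.mem_image.1 hw
      refine ⟨fun e => (Finset.mem_erase.1 hj).1 (h'.inj e), fun l hl => ?_⟩
      exact (h.support_node_iff h' i l).1 (h'.trans _ j (Finset.mem_of_mem_erase hj) l hl)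
  have hmem : R (ν' i) ∈ span ℝ (R '' (T : Set V)) := by
    have h1 := h'.mem_rowSpan_of_notMem hnr
    rw [rowSpan, ← Finset.insert_erase hmi, Finset.coe_insert, Set.image_insert_eq] at h1
    have h2 : R (ν i) ∉ rowSpan R ν' ((p' (ν i)).erase i) := by
      intro hc
      have := (h'.parents_subset_iff hnr).1 hc hmi
      simp at this
    rw [hT, Finset.coe_insert, Set.image_insert_eq, Finset.coe_image, Set.image_image]
    exact mem_span_insert_exchange h1 h2
  have key := h.indep (ν' i) T hpp
  rw [own_of_notMem hnr', sub_zero, hcard] at key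
  constructor
  · by_contra! hc
    have := (key hc.le hmem).1
    omega
  · intro e
    rw [rowSpan_le]
    intro j hj
    by_cases hji : j = i
    · rw [hji]
      exact h.mem_rowSpan_of_notMem hnr'
    · exact (key e.le hmem).2 _ (Finset.mem_insert_of_mem
        (Finset.mem_image_of_mem _ (Finset.mem_erase.2 ⟨hji, hj⟩)))

/-- The second model gives `ν i` the role that `ν' i` has in the first one. -/
theorem rowSpan_eq_of_ne_leaf (h : RowFaithful R ν p) (h' : RowFaithful R ν' p') {i : ι}
    (hi : ν' i ≠ ν i) : rowSpan R ν' (p' (ν i)) = rowSpan R ν (p (ν' i)) := by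
  have h1 := h.rowSpan_le_leaf h' hi
  have h2 := h'.rowSpan_le_leaf h hi.symm
  exact le_antisymm (h1.2 (le_antisymm h2.1 h1.1)) (h2.2 (le_antisymm h1.1 h2.1))

/-- The spans of sets of parents are the same in both models. -/
theorem exists_rowSpan_eq (h : RowFaithful R ν p) (h' : RowFaithful R ν' p') (w : V) :
    ∃ w', rowSpan R ν' (p' w') = rowSpan R ν (p w) := by
  by_cases hw : ∀ j, ν j = w ↔ ν' j = w
  · exact ⟨w, h.rowSpan_eq_of_fixed h' hw⟩
  · push Not at hw
    obtain ⟨j, ⟨rfl, hj⟩ | ⟨hj, rfl⟩⟩ := hw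
    · exact ⟨ν' j, h.rowSpan_eq_of_ne_node h' hj⟩
    · exact ⟨ν j, h.rowSpan_eq_of_ne_leaf h' (Ne.symm hj)⟩

/-- If two faithful models with the same rows attach the noise term `i` to different variables, then
these two variables can be exchanged. -/
theorem exchangeable_of_ne (h : RowFaithful R ν p) (h' : RowFaithful R ν' p') {i : ι}
    (hi : ν' i ≠ ν i) : Exchangeable ν p i (ν' i) := by
  have hm := h.mem_parents_of_ne h' hi
  have hnr := h.notMem_range_of_ne h' hi
  refine ⟨hnr, hm, ?_, fun w hw => ?_⟩
  · have h1 : insert i (p (ν i)) = p (ν i) ∪ p (ν' i) := by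
      refine Finset.eq_of_subset_of_card_le (Finset.insert_subset
        (Finset.mem_union_right _ hm) Finset.subset_union_left) ?_
      rw [(h.card_union_eq h' hi).1, Finset.card_insert_of_notMem (h.notMem_parents_self i)]
    rw [h1]
    exact Finset.subset_union_right
  · obtain ⟨w', hw'⟩ := h.exists_rowSpan_eq h' w
    have h1 : p' (ν i) ⊆ p' w' :=
      (h'.parents_subset_iff (h'.notMem_range_of_ne h hi.symm)).1 (hw' ▸ mem_rowSpan hw)
    rw [← h.parents_subset_iff hnr, ← hw']
    exact mem_rowSpan (h1 (h'.mem_parents_of_ne h hi.symm))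

end RowFaithful

end RowModel

/-! ### Exchanging nodes with leaves -/

namespace RowModel

open Submodule

variable {V ι : Type*}

/-- `σ` is the involution that exchanges `ν i` with `c i` for each `i`. -/
structure IsExchange (ν c : ι → V) (σ : Equiv.Perm V) : Prop where
  invol : ∀ v, σ (σ v) = v
  node : ∀ i, σ (ν i) = c i
  fixed : ∀ v, (∀ i, ν i ≠ v) → (∀ i, c i ≠ v) → σ v = v

namespace IsExchange

variable {ν c : ι → V} {σ : Equiv.Perm V}

theorem choice (hσ : IsExchange ν c σ) (i : ι) : σ (c i) = ν i := by
  rw [← hσ.node, hσ.invol]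

theorem injective_choice (hσ : IsExchange ν c σ) (hν : Function.Injective ν) :
    Function.Injective c := by
  intro i j hij
  exact hν (by rw [← hσ.choice, hij, hσ.choice])

theorem node_eq_iff (hσ : IsExchange ν c σ) {i : ι} {v : V} :
    ν i = σ v ↔ c i = v := by
  rw [← hσ.choice i]
  exact σ.injective.eq_iff

theorem cases (hσ : IsExchange ν c σ) (w : V) :
    (σ w = w ∧ ∀ j, ν j = w ↔ c j = w) ∨ ∃ i, c i ≠ ν i ∧ (w = c i ∨ w = ν i) := by
  by_cases h1 : ∃ i, ν i = w
  · obtain ⟨i, rfl⟩ := h1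
    by_cases hi : c i = ν i
    · refine Or.inl ⟨by rw [hσ.node, hi], fun j => ⟨fun e => ?_, fun e => ?_⟩⟩
      · rw [← hσ.node, e, hσ.node, hi]
      · rw [← hσ.choice, e, hσ.node, hi]
    · exact Or.inr ⟨i, hi, Or.inr rfl⟩
  by_cases h2 : ∃ i, c i = w
  · obtain ⟨i, rfl⟩ := h2
    exact Or.inr ⟨i, fun e => h1 ⟨i, e.symm⟩, Or.inl rfl⟩
  push Not at h1 h2
  exact Or.inl ⟨hσ.fixed w h1 h2, fun j => iff_of_false (h1 j) (h2 j)⟩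

/-- Exchanging the variables exchanges the possible exchange partners. -/
theorem exchangeable_iff [DecidableEq ι] {p : V → Finset ι} (hσ : IsExchange ν c σ)
    {i : ι} {l : V} :
    Exchangeable c (fun v => p (σ v)) i l ↔ Exchangeable ν p i (σ l) := by
  constructor
  · rintro ⟨h1, h2, h3, h4⟩
    refine ⟨fun j => mt hσ.node_eq_iff.1 (h1 j), h2, by simpa only [hσ.choice] using h3,
      fun w hw => ?_⟩
    simpa only [hσ.invol] using h4 (σ w) (by simpa only [hσ.invol] using hw)
  · rintro ⟨h1, h2, h3, h4⟩
    exact ⟨fun j => mt hσ.node_eq_iff.2 (h1 j), h2, by simpa only [hσ.choice] using h3,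
      fun w => h4 (σ w)⟩

end IsExchange

namespace RowFaithful

variable [DecidableEq ι] {R : V → ι → ℝ} {ν c : ι → V} {p : V → Finset ι}

/-- Otherwise `ν i` and `ν j`, being parents of `s`, would be parents of each other. -/
theorem exchangeable_unique (h : RowFaithful R ν p) {i j : ι} {s : V}
    (hi : Exchangeable ν p i s) (hj : Exchangeable ν p j s) : i = j := by
  by_contra hne
  have h1 : j ∈ p (ν i) := (Finset.mem_insert.1 (hi.subset hj.parent)).resolve_left (Ne.symm hne)
  have h2 : i ∈ p (ν j) := (Finset.mem_insert.1 (hj.subset hi.parent)).resolve_left hne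
  exact hne (h.support_antisymm (h.support_parent h1) (h.support_parent h2))

theorem exists_isExchange (h : RowFaithful R ν p)
    (hc : ∀ i, c i ≠ ν i → Exchangeable ν p i (c i)) : ∃ σ, IsExchange ν c σ := by
  classical
  have hcν : ∀ i j, c i = ν j → i = j := by
    intro i j hij
    by_cases hi : c i = ν i
    · exact h.inj (hi.symm.trans hij)
    · exact ((hc i hi).notMem j hij.symm).elim
  have hcinj : Function.Injective c := by
    intro i j hij
    by_cases hi : c i = ν i
    · exact (hcν j i (hij.symm.trans hi)).symm
    by_cases hj : c j = ν j
    · exact hcν i j (hij.trans hj)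
    exact h.exchangeable_unique (hij ▸ hc i hi) (hc j hj)
  let f : V → V := fun v =>
    if hv : ∃ i, ν i = v then c hv.choose else if hv : ∃ i, c i = v then ν hv.choose else v
  have hf1 : ∀ i, f (ν i) = c i := by
    intro i
    have hv : ∃ j, ν j = ν i := ⟨i, rfl⟩
    simp only [f, hv, dif_pos]
    rw [h.inj hv.choose_spec]
  have hf2 : ∀ i, f (c i) = ν i := by
    intro i
    by_cases hv : ∃ j, ν j = c i
    · obtain ⟨j, hj⟩ := hv
      obtain rfl := hcν i j hj.symm
      rw [← hj, hf1, hj]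
    · have hv' : ∃ j, c j = c i := ⟨i, rfl⟩
      simp only [f, hv, hv', dif_pos, dif_neg, not_false_iff]
      rw [hcinj hv'.choose_spec]
  have hf3 : ∀ v, (∀ i, ν i ≠ v) → (∀ i, c i ≠ v) → f v = v := by
    intro v h1 h2
    simp [f, h1, h2]
  have hinv : Function.Involutive f := by
    intro v
    by_cases h1 : ∃ i, ν i = v
    · obtain ⟨i, rfl⟩ := h1
      rw [hf1, hf2]
    by_cases h2 : ∃ i, c i = v
    · obtain ⟨i, rfl⟩ := h2
      rw [hf2, hf1]
    push Not at h1 h2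
    rw [hf3 v h1 h2, hf3 v h1 h2]
  exact ⟨hinv.toPerm, hinv, hf1, hf3⟩

variable {σ : Equiv.Perm V} (h : RowFaithful R ν p)
  (hc : ∀ i, c i ≠ ν i → Exchangeable ν p i (c i)) (hσ : IsExchange ν c σ)

include h hc

theorem support_choice_iff (i j : ι) : R (c i) j ≠ 0 ↔ R (ν i) j ≠ 0 := by
  by_cases hi : c i = ν i
  · rw [hi]
  have he := hc i hi
  refine ⟨fun hj => ?_, h.trans _ i he.parent j⟩
  rcases h.eq_or_exists_parent hj with e | ⟨a, ha, haj⟩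
  · exact (he.notMem j e).elim
  · rcases Finset.mem_insert.1 (he.subset ha) with rfl | ha
    · exact haj
    · exact h.trans _ a ha j haj

theorem diag_choice (i : ι) : R (c i) i ≠ 0 :=
  (h.support_choice_iff hc i i).2 (h.diag i)

theorem notMem_range_choice {i : ι} (hi : c i ≠ ν i) (j : ι) : c j ≠ ν i := by
  intro e
  by_cases hj : c j = ν j
  · have := h.inj (hj.symm.trans e)
    exact hi (this ▸ hj)
  · exact (hc j hj).notMem i e.symm

omit h in
theorem parents_choice_subset {w : V} {i : ι} (hw : i ∈ p w) (hi : c i ≠ ν i) : p (c i) ⊆ p w :=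
  (hc i hi).closed w hw

/-- A set of nodes that contains, with each node, the parents of its exchange partner spans the same
space before and after the exchange. -/
theorem rowSpan_choice {Q : Finset ι} (hQ : ∀ i ∈ Q, c i ≠ ν i → p (c i) ⊆ Q) :
    rowSpan R c Q = rowSpan R ν Q := by
  apply le_antisymm
  · rw [rowSpan_le]
    intro i hi
    by_cases hci : c i = ν i
    · rw [hci]
      exact mem_rowSpan hi
    · exact rowSpan_mono (hQ i hi hci) (h.mem_rowSpan_of_notMem (hc i hci).notMem)
  · rw [rowSpan_le]
    obtain ⟨r, hr⟩ := h.acyclic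
    intro i hi
    induction hn : r (ν i) using Nat.strong_induction_on generalizing i with
    | _ n ih =>
      by_cases hci : c i = ν i
      · rw [← hci]
        exact mem_rowSpan hi
      have he := hc i hci
      -- solve the equation of `c i` for the row of `ν i`
      have h1 := h.mem_rowSpan_of_notMem he.notMem
      rw [rowSpan, ← Finset.insert_erase he.parent, Finset.coe_insert, Set.image_insert_eq,
        mem_span_insert] at h1
      obtain ⟨a, z, hz, hR⟩ := h1
      have hz' : z ∈ rowSpan R c Q := by
        refine rowSpan_le.2 (fun j hj => ?_) hz
        obtain ⟨hji, hj⟩ := Finset.mem_erase.1 hj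
        refine ih _ ?_ j (hQ i hi hci hj) rfl
        rw [← hn]
        exact hr _ j ((Finset.mem_insert.1 (he.subset hj)).resolve_left hji)
      have ha : a ≠ 0 := by
        rintro rfl
        have h2 : z i = 0 := by
          refine apply_eq_zero_of_mem_rowSpan hz fun j hj => ?_
          obtain ⟨hji, hj⟩ := Finset.mem_erase.1 hj
          exact h.apply_eq_zero_of_mem_parents
            ((Finset.mem_insert.1 (he.subset hj)).resolve_left hji)
        exact h.diag_choice hc i (by rw [hR]; simp [h2])
      have h3 : a • R (ν i) ∈ rowSpan R c Q := by
        rw [eq_sub_of_add_eq hR.symm]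
        exact sub_mem (mem_rowSpan hi) hz'
      simpa [smul_smul, ha] using smul_mem _ a⁻¹ h3

theorem rowSpan_parents_choice (w : V) : rowSpan R c (p w) = rowSpan R ν (p w) :=
  h.rowSpan_choice hc fun _ hi => parents_choice_subset hc hi

theorem rowSpan_parents_union_choice (v w : V) :
    rowSpan R c (p v ∪ p w) = rowSpan R ν (p v ∪ p w) := by
  refine h.rowSpan_choice hc fun i hi hci => ?_
  rcases Finset.mem_union.1 hi with hi | hi
  · exact (parents_choice_subset hc hi hci).trans Finset.subset_union_left
  · exact (parents_choice_subset hc hi hci).trans Finset.subset_union_right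

omit hc in
theorem mem_rowSpan_of_mem_insert {i : ι} {x : ι → ℝ}
    (hx : x ∈ rowSpan R ν (insert i (p (ν i)))) (hi : x i = 0) : x ∈ rowSpan R ν (p (ν i)) := by
  rw [rowSpan, Finset.coe_insert, Set.image_insert_eq, mem_span_insert] at hx
  obtain ⟨a, z, hz, rfl⟩ := hx
  have h2 : z i = 0 :=
    apply_eq_zero_of_mem_rowSpan hz fun j hj => h.apply_eq_zero_of_mem_parents hj
  have ha : a = 0 := by simpa [h2, h.diag i] using hi
  rwa [ha, zero_smul, zero_add]

omit h in
theorem union_parents_choice {i : ι} (hi : c i ≠ ν i) :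
    p (ν i) ∪ p (c i) = insert i (p (ν i)) := by
  have he := hc i hi
  refine le_antisymm (Finset.union_subset (Finset.subset_insert _ _) he.subset) ?_
  exact Finset.insert_subset (Finset.mem_union_right _ he.parent) Finset.subset_union_left

theorem possPa_choice_iff (hcinj : Function.Injective c) {x : ι} {w : V} :
    PossPa R c (c x) w ↔ PossPa R ν (ν x) w := by
  rw [possPa_node_iff h.inj h.diag, possPa_node_iff hcinj (h.diag_choice hc)]
  simp only [h.support_choice_iff hc]

/-- The row of `c i`, without the noise term which it takes over, is spanned by the parents of
`ν i`. -/
theorem mem_rowSpan_choice {i : ι} (hi : c i ≠ ν i) :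
    R (c i) - Pi.single i (R (c i) i) ∈ rowSpan R ν (p (ν i)) := by
  apply h.mem_rowSpan_of_mem_insert _ (by simp)
  have h1 : R (c i) ∈ rowSpan R ν (insert i (p (ν i))) :=
    rowSpan_mono (hc i hi).subset (h.mem_rowSpan_of_notMem (hc i hi).notMem)
  have h2 : R (ν i) - Pi.single i (R (ν i) i) ∈ rowSpan R ν (insert i (p (ν i))) :=
    rowSpan_mono (Finset.subset_insert _ _) (h.mem_rowSpan_sub_single i)
  have h3 : Pi.single i (R (ν i) i) ∈ rowSpan R ν (insert i (p (ν i))) := by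
    simpa using sub_mem (mem_rowSpan (Finset.mem_insert_self _ _)) h2
  refine sub_mem h1 ?_
  have h4 := smul_mem _ (R (c i) i / R (ν i) i) h3
  rwa [← Pi.single_smul, smul_eq_mul, div_mul_cancel₀ _ (h.diag i)] at h4

/-- The variable `ν i` has lost its noise term, and its row is to be represented by other rows.  One
of these belongs to a leaf `q` which has `ν i` as a last ancestor, so it can be exchanged with the
row of `ν i`, and `p (c i) ⊆ p q` makes faithfulness at `q` sufficient. -/
theorem indep_old_node {i : ι} (hi : c i ≠ ν i) {T : Finset V}
    (hT : ∀ w ∈ T, PossPa R c (ν i) w) (hcard : T.card ≤ (p (c i)).card)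
    (hmem : R (ν i) ∈ span ℝ (R '' (T : Set V))) :
    T.card = (p (c i)).card ∧ ∀ w ∈ T, R w ∈ rowSpan R ν (p (c i)) := by
  classical
  have hT' : ∀ w ∈ T, w ≠ ν i ∧ ∀ j, R w j ≠ 0 → R (ν i) j ≠ 0 := fun w hw =>
    (possPa_of_notMem_iff (h.notMem_range_choice hc hi)).1 (hT w hw)
  obtain ⟨a, ha⟩ := (mem_span_image_finset_iff_exists_fun' ℝ).1 hmem
  obtain ⟨q, hq, hqi⟩ : ∃ q ∈ T, a q * R q i ≠ 0 := by
    apply Finset.exists_ne_zero_of_sum_ne_zero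
    have := congrFun ha i
    simp only [Finset.sum_apply, Pi.smul_apply, smul_eq_mul] at this
    rw [this]
    exact h.diag i
  have haq := left_ne_zero_of_mul hqi
  have hRq := right_ne_zero_of_mul hqi
  have hqν : ∀ j, ν j ≠ q := by
    rintro j rfl
    have := h.support_antisymm hRq ((hT' _ hq).2 j (h.diag j))
    exact (hT' _ hq).1 (by rw [this])
  have hpq : p (c i) ⊆ p q := by
    exact parents_choice_subset hc (h.mem_parents_of_support_le hqν hRq (hT' q hq).2) hi
  have hνT : ν i ∉ T.erase q := fun hm => (hT' _ (Finset.mem_of_mem_erase hm)).1 rfl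
  have hTcard : (insert (ν i) (T.erase q)).card = T.card := by
    rw [Finset.card_insert_of_notMem hνT, Finset.card_erase_of_mem hq]
    have := Finset.card_pos.2 ⟨q, hq⟩
    omega
  have key := h.indep q (insert (ν i) (T.erase q)) (by
    intro w hw
    rw [possPa_of_notMem_iff hqν]
    have hs : ∀ j, R (ν i) j ≠ 0 → R q j ≠ 0 := fun j => h.support_trans hRq
    rcases Finset.mem_insert.1 hw with rfl | hw
    · exact ⟨(hT' q hq).1.symm, hs⟩
    · obtain ⟨hwq, hw⟩ := Finset.mem_erase.1 hw
      exact ⟨hwq, fun j hj => hs j ((hT' w hw).2 j hj)⟩)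
    (by rw [hTcard]; exact hcard.trans (Finset.card_le_card hpq)) (by
    rw [own_of_notMem hqν, sub_zero]
    rw [← Finset.add_sum_erase _ _ hq] at ha
    have h1 : a q • R q ∈ span ℝ (R '' ((insert (ν i) (T.erase q) : Finset V) : Set V)) := by
      rw [eq_sub_of_add_eq ha]
      refine sub_mem (subset_span ⟨ν i, by simp, rfl⟩) (sum_mem fun w hw => smul_mem _ _ ?_)
      exact subset_span ⟨w, Finset.mem_coe.2 (Finset.mem_insert_of_mem hw), rfl⟩
    simpa [smul_smul, haq] using smul_mem _ (a q)⁻¹ h1)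
  rw [hTcard] at key
  have heq : p (c i) = p q := Finset.eq_of_subset_of_card_le hpq (by rw [← key.1]; exact hcard)
  rw [heq]
  refine ⟨key.1, fun w hw => ?_⟩
  by_cases hwq : w = q
  · rw [hwq]
    exact h.mem_rowSpan_of_notMem hqν
  · exact key.2 w (Finset.mem_insert_of_mem (Finset.mem_erase.2 ⟨hwq, hw⟩))

include hσ

theorem indep_exchange (v : V) (T : Finset V) (hT : ∀ w ∈ T, PossPa R c v w)
    (hcard : T.card ≤ (p (σ v)).card) (hmem : R v - own R c v ∈ span ℝ (R '' (T : Set V))) :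
    T.card = (p (σ v)).card ∧ ∀ w ∈ T, R w ∈ rowSpan R c (p (σ v)) := by
  rw [h.rowSpan_parents_choice hc]
  rcases hσ.cases v with ⟨hv, hv'⟩ | ⟨i, hi, rfl | rfl⟩
  · have hown : own R c v = own R ν v := (own_congr hv').symm
    rw [hv] at hcard ⊢
    refine h.indep v T (fun w hw => ?_) hcard (hown ▸ hmem)
    simpa only [PossPa, ne_eq, hv'] using hT w hw
  · rw [own_node (hσ.injective_choice h.inj)] at hmem
    rw [hσ.choice] at hcard ⊢
    have he := hc i hi
    have hT' := fun w hw => (h.possPa_choice_iff hc (hσ.injective_choice h.inj)).1 (hT w hw)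
    have key := h.indep' (c i) he.notMem i he.parent T hT'
    rw [union_parents_choice hc hi, Finset.card_insert_of_notMem (h.notMem_parents_self i)] at key
    obtain ⟨h1, h2⟩ := key (by omega) hmem
    refine ⟨by omega, fun w hw => h.mem_rowSpan_of_mem_insert (h2 w hw) ?_⟩
    by_contra h0
    exact ((hT' w hw).2 i h0).2 rfl
  · rw [own_of_notMem (h.notMem_range_choice hc hi), sub_zero] at hmem
    rw [hσ.node] at hcard ⊢
    exact h.indep_old_node hc hi hT hcard hmem

theorem indep_exchange' (u : V) (hu : ∀ i, c i ≠ u) (x : ι) (hx : x ∈ p (σ u)) (T : Finset V)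
    (hT : ∀ w ∈ T, PossPa R c (c x) w) (hcard : T.card + 1 ≤ (p (σ (c x)) ∪ p (σ u)).card)
    (hmem : R u - Pi.single x (R u x) ∈ span ℝ (R '' (T : Set V))) :
    T.card + 1 = (p (σ (c x)) ∪ p (σ u)).card ∧
      ∀ w ∈ T, R w ∈ rowSpan R c (p (σ (c x)) ∪ p (σ u)) := by
  rw [h.rowSpan_parents_union_choice hc]
  rw [hσ.choice] at hcard ⊢
  have hT' := fun w hw => (h.possPa_choice_iff hc (hσ.injective_choice h.inj)).1 (hT w hw)
  rcases hσ.cases u with ⟨hv, hv'⟩ | ⟨i, hi, rfl | rfl⟩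
  · rw [hv] at hcard hx ⊢
    exact h.indep' u (fun i hi => hu i ((hv' i).1 hi)) x hx T hT' hcard hmem
  · exact (hu i rfl).elim
  rw [hσ.node] at hcard hx ⊢
  by_cases hxi : x = i
  · subst hxi
    rw [union_parents_choice hc hi, Finset.card_insert_of_notMem (h.notMem_parents_self x)]
      at hcard ⊢
    obtain ⟨h1, h2⟩ := h.indep (ν x) T hT' (by omega) (by rwa [own_node h.inj])
    exact ⟨by omega, fun w hw => rowSpan_mono (Finset.subset_insert _ _) (h2 w hw)⟩
  · -- the rows in `T` do not involve the noise term `i`, which is a descendant of `x`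
    have hx' : x ∈ p (ν i) := (Finset.mem_insert.1 ((hc i hi).subset hx)).resolve_left hxi
    have h0 := apply_eq_zero_of_mem_span (j := i) hmem (fun w hw => by
      by_contra h0
      exact hxi (h.support_antisymm ((hT' w hw).2 i h0).1 (h.support_parent hx')))
    rw [Pi.sub_apply, Pi.single_eq_of_ne (Ne.symm hxi), sub_zero] at h0
    exact (h.diag i h0).elim

/-- Exchanging nodes with exchangeable leaves leads to a faithful model with the same rows, whose
diagram arises from the original one by exchanging the variables. -/
theorem exchange : RowFaithful R c fun v => p (σ v) where
  inj := hσ.injective_choice h.inj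
  diag := h.diag_choice hc
  mem v := by
    rw [h.rowSpan_parents_choice hc]
    rcases hσ.cases v with ⟨hv, hv'⟩ | ⟨i, hi, rfl | rfl⟩
    · have hown : own R c v = own R ν v := (own_congr hv').symm
      rw [hv, hown]
      exact h.mem v
    · rw [own_node (hσ.injective_choice h.inj), hσ.choice]
      exact h.mem_rowSpan_choice hc hi
    · rw [own_of_notMem (h.notMem_range_choice hc hi), sub_zero, hσ.node]
      exact mem_rowSpan (hc i hi).parent
  acyclic := by
    obtain ⟨r, hr⟩ := h.acyclic
    refine ⟨fun v => r (σ v), fun v i hi => ?_⟩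
    simpa only [hσ.choice] using hr _ i hi
  trans v a ha j hj := by
    rw [h.support_choice_iff hc] at hj
    have h1 := h.trans _ a ha j hj
    rcases hσ.cases v with ⟨hv, -⟩ | ⟨i, hi, rfl | rfl⟩
    · rwa [hv] at h1
    · rw [hσ.choice] at h1
      exact (h.support_choice_iff hc i j).2 h1
    · rw [hσ.node] at h1
      exact (h.support_choice_iff hc i j).1 h1
  indep := h.indep_exchange hc hσ
  indep' := h.indep_exchange' hc hσ

end RowFaithful

end RowModel

/-! ### Total effects in acyclic diagrams -/

namespace Diagram

variable {V : Type*} [Fintype V] {K : Matrix V V ℝ}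

theorem hasCausalOrder_of_lt {r : V → ℕ} (hr : ∀ j i, Edge K j i → r j < r i) :
    HasCausalOrder K := by
  let f := Fintype.equivFin V
  -- ties of `r` are broken by an arbitrary enumeration
  refine ⟨fun v => r v * Fintype.card V + f v, fun v w hvw => ?_, fun j i hji => ?_⟩
  · have h1 := congrArg (· % Fintype.card V) hvw
    simp only [Nat.mul_add_mod_self_right, Nat.mod_eq_of_lt (f _).is_lt] at h1
    exact f.injective (Fin.ext h1)
  · have h1 := hr j i hji
    have h2 := (f j).is_lt
    calc r j * Fintype.card V + f j < (r j + 1) * Fintype.card V := by rw [add_mul]; omega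
      _ ≤ r i * Fintype.card V := Nat.mul_le_mul_right _ h1
      _ ≤ _ := Nat.le_add_right _ _

theorem mem_pa {i j : V} : j ∈ pa K i ↔ Edge K j i := by simp [pa]

theorem mem_ch {i j : V} : j ∈ ch K i ↔ Edge K i j := by simp [ch]

theorem mem_an {i j : V} : j ∈ an K i ↔ Relation.TransGen (Edge K) j i := by simp [an]

theorem mem_de {i j : V} : j ∈ de K i ↔ Relation.TransGen (Edge K) i j := by simp [de]

omit [Fintype V] in
theorem lt_of_transGen {r : V → ℕ} (hr : ∀ j i, Edge K j i → r j < r i) {j i : V}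
    (h : Relation.TransGen (Edge K) j i) : r j < r i := by
  induction h with
  | single h => exact hr _ _ h
  | tail _ h ih => exact ih.trans (hr _ _ h)

omit [Fintype V] in
theorem HasCausalOrder.ne_of_transGen (hK : HasCausalOrder K) {j i : V}
    (h : Relation.TransGen (Edge K) j i) : j ≠ i := by
  obtain ⟨r, -, hr⟩ := hK
  rintro rfl
  exact lt_irrefl _ (lt_of_transGen hr h)

variable [DecidableEq V]

theorem HasCausalOrder.pow_card_eq_zero (hK : HasCausalOrder K) : K ^ Fintype.card V = 0 := by
  classical
  obtain ⟨r, -, hr⟩ := hK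
  -- the position of a variable among the values of `r`
  let s : V → ℕ := fun v => (Finset.univ.filter fun w => r w < r v).card
  have hs : ∀ j i, Edge K j i → s j < s i := by
    intro j i hji
    apply Finset.card_lt_card
    refine Finset.ssubset_iff_of_subset (fun w hw => ?_) |>.2 ⟨j, ?_, ?_⟩
    · simp only [Finset.mem_filter, Finset.mem_univ, true_and] at hw ⊢
      exact hw.trans (hr j i hji)
    · simpa using hr j i hji
    · simp
  have hlt : ∀ v, s v < Fintype.card V := fun v =>
    Finset.card_lt_univ_of_notMem (x := v) (by simp)
  have hpow : ∀ n i j, (K ^ n) i j ≠ 0 → s j + n ≤ s i := by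
    intro n
    induction n with
    | zero =>
      intro i j hij
      by_cases h : i = j
      · simp [h]
      · simp [Matrix.one_apply_ne h] at hij
    | succ n ih =>
      intro i j hij
      rw [pow_succ, Matrix.mul_apply] at hij
      obtain ⟨w, -, hw⟩ := Finset.exists_ne_zero_of_sum_ne_zero hij
      have h1 := ih i w (left_ne_zero_of_mul hw)
      have h2 := hs j w (right_ne_zero_of_mul hw)
      omega
  ext i j
  by_contra h
  have h1 := hpow _ i j h
  have h2 := hlt i
  omega

theorem HasCausalOrder.sum_pow_mul (hK : HasCausalOrder K) :
    (∑ n ∈ Finset.range (Fintype.card V), K ^ n) * (1 - K) = 1 := by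
  rw [geom_sum_mul_neg, hK.pow_card_eq_zero, sub_zero]

theorem HasCausalOrder.totalEffect_eq (hK : HasCausalOrder K) (i j : V) :
    totalEffect K i j = (1 - K)⁻¹ j i := by
  rw [Matrix.inv_eq_left_inv hK.sum_pow_mul, totalEffect, Matrix.sum_apply]

theorem HasCausalOrder.isUnit_det (hK : HasCausalOrder K) : IsUnit (1 - K).det :=
  Matrix.isUnit_det_of_left_inverse hK.sum_pow_mul

theorem HasCausalOrder.inv_apply (hK : HasCausalOrder K) (i j : V) :
    (1 - K)⁻¹ i j = (1 : Matrix V V ℝ) i j + ∑ w, K i w * (1 - K)⁻¹ w j := by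
  have h := Matrix.mul_nonsing_inv _ hK.isUnit_det
  rw [sub_mul, one_mul, sub_eq_iff_eq_add] at h
  conv_lhs => rw [h]
  rw [Matrix.add_apply, Matrix.mul_apply]

theorem HasCausalOrder.eq_or_transGen (hK : HasCausalOrder K) {i j : V}
    (h : (1 - K)⁻¹ i j ≠ 0) : j = i ∨ Relation.TransGen (Edge K) j i := by
  obtain ⟨r, -, hr⟩ := id hK
  induction hn : r i using Nat.strong_induction_on generalizing i with
  | _ n ih =>
    by_cases hij : j = i
    · exact Or.inl hij
    rw [hK.inv_apply, Matrix.one_apply_ne (Ne.symm hij), zero_add] at h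
    obtain ⟨w, -, hw⟩ := Finset.exists_ne_zero_of_sum_ne_zero h
    have hwi : Edge K w i := left_ne_zero_of_mul hw
    right
    rcases ih _ (hn ▸ hr w i hwi) (right_ne_zero_of_mul hw) rfl with rfl | h1
    · exact .single hwi
    · exact h1.tail hwi

theorem HasCausalOrder.inv_apply_self (hK : HasCausalOrder K) (i : V) : (1 - K)⁻¹ i i = 1 := by
  obtain ⟨r, -, hr⟩ := id hK
  rw [hK.inv_apply, Matrix.one_apply_eq, add_eq_left]
  refine Finset.sum_eq_zero fun w _ => ?_
  by_contra h
  have h1 : Edge K w i := left_ne_zero_of_mul h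
  rcases hK.eq_or_transGen (right_ne_zero_of_mul h) with rfl | h2
  · exact lt_irrefl _ (hr _ _ h1)
  · exact lt_irrefl _ (lt_of_transGen hr (h2.tail h1))

/-- The total effects are determined by the structural equations. -/
theorem HasCausalOrder.eq_mul_inv_apply (hK : HasCausalOrder K) {x : V → ℝ} {a : ℝ} {j : V}
    (hx : ∀ v, x v = (if v = j then a else 0) + ∑ w, K v w * x w) (v : V) :
    x v = a * (1 - K)⁻¹ v j := by
  have h1 : (1 - K) *ᵥ x = Pi.single j a := by
    ext v
    rw [Matrix.sub_mulVec, Matrix.one_mulVec, Pi.sub_apply, Pi.single_apply, Matrix.mulVec,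
      dotProduct, sub_eq_iff_eq_add]
    exact hx v
  have h2 : x = (1 - K)⁻¹ *ᵥ Pi.single j a := by
    rw [← h1, Matrix.mulVec_mulVec, Matrix.nonsing_inv_mul _ hK.isUnit_det, Matrix.one_mulVec]
  rw [h2, Matrix.mulVec_single]
  simp [mul_comm]

end Diagram

/-! ### Faithfulness of a model in terms of its rows -/

namespace SEMME

open Diagram Submodule RowModel

variable {V ι : Type*}

theorem nuLeaf_of_edge (M : SEMME V) {v w : V} (h : Edge M.coef v w) : M.NULeaf v :=
  fun hv => hv.2 w h

variable [Fintype V] [DecidableEq V]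

/-- The rows `R` are the total effects of the nu-leaf nodes `ν i`, up to the nonzero factors `r` of
the variables and `t` of the noise terms. -/
structure Presents (M : SEMME V) (R : V → ι → ℝ) (ν : ι → V) (r : V → ℝ) (t : ι → ℝ) : Prop where
  inj : Function.Injective ν
  range : ∀ v, M.NULeaf v ↔ ∃ i, ν i = v
  row_ne : ∀ v, r v ≠ 0
  col_ne : ∀ i, t i ≠ 0
  apply_eq : ∀ v i, R v i = r v * t i * (1 - M.coef)⁻¹ v (ν i)

variable [Fintype ι]

/-- The parents of `v`, as a set of indices of nu-leaf nodes. -/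
noncomputable def parentIdx (M : SEMME V) (ν : ι → V) (v : V) : Finset ι :=
  Finset.univ.filter fun i => ν i ∈ pa M.coef v

theorem mem_parentIdx {M : SEMME V} {ν : ι → V} {i : ι} {v : V} :
    i ∈ M.parentIdx ν v ↔ ν i ∈ pa M.coef v := by
  simp [parentIdx]

theorem edge_node_iff {M : SEMME V} {ν : ι → V} {i : ι} {v : V} :
    Edge M.coef (ν i) v ↔ i ∈ M.parentIdx ν v := by
  rw [mem_parentIdx, mem_pa]

namespace Presents

variable {M : SEMME V} {R : V → ι → ℝ} {ν : ι → V} {r : V → ℝ} {t : ι → ℝ}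
  (h : Presents M R ν r t)

include h

omit [Fintype ι] in
theorem uLeaf_iff (v : V) : M.ULeaf v ↔ ∀ i, ν i ≠ v := by
  rw [← not_iff_not]
  push Not
  exact h.range v

omit [Fintype ι] in
theorem exists_node_of_edge {v w : V} (hvw : Edge M.coef v w) : ∃ i, ν i = v :=
  (h.range v).1 (M.nuLeaf_of_edge hvw)

omit [Fintype ι] in
theorem apply_ne_zero_iff (v : V) (i : ι) : R v i ≠ 0 ↔ totalEffect M.coef (ν i) v ≠ 0 := by
  rw [h.apply_eq, M.causalOrder.totalEffect_eq]
  simp [h.row_ne, h.col_ne]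

omit [Fintype ι] in
theorem diag (i : ι) : R (ν i) i ≠ 0 := by
  rw [h.apply_ne_zero_iff, M.causalOrder.totalEffect_eq, M.causalOrder.inv_apply_self]
  exact one_ne_zero

theorem map_parentIdx (v : V) : (M.parentIdx ν v).map ⟨ν, h.inj⟩ = pa M.coef v := by
  ext w
  simp only [Finset.mem_map, mem_parentIdx, Function.Embedding.coeFn_mk]
  constructor
  · rintro ⟨i, hi, rfl⟩
    exact hi
  · intro hw
    obtain ⟨i, rfl⟩ := h.exists_node_of_edge (mem_pa.1 hw)
    exact ⟨i, hw, rfl⟩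

theorem card_parentIdx (v : V) : (M.parentIdx ν v).card = (pa M.coef v).card := by
  rw [← h.map_parentIdx, Finset.card_map]

theorem card_union_parentIdx [DecidableEq ι] (v w : V) :
    (M.parentIdx ν v ∪ M.parentIdx ν w).card = (pa M.coef v ∪ pa M.coef w).card := by
  rw [← h.map_parentIdx, ← h.map_parentIdx, ← Finset.map_union, Finset.card_map]

theorem parentIdx_subset_iff (v w : V) :
    M.parentIdx ν v ⊆ M.parentIdx ν w ↔ pa M.coef v ⊆ pa M.coef w := by
  rw [← h.map_parentIdx, ← h.map_parentIdx w, Finset.map_subset_map]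

theorem parentIdx_subset_union_iff [DecidableEq ι] (u v w : V) :
    M.parentIdx ν u ⊆ M.parentIdx ν v ∪ M.parentIdx ν w ↔
      pa M.coef u ⊆ pa M.coef v ∪ pa M.coef w := by
  rw [← h.map_parentIdx, ← h.map_parentIdx v, ← h.map_parentIdx w, ← Finset.map_union,
    Finset.map_subset_map]

theorem sub_own_eq (v : V) :
    R v - own R ν v = ∑ i, (M.coef v (ν i) * (r v / r (ν i))) • R (ν i) := by
  ext j
  have h1 := M.causalOrder.inv_apply v (ν j)
  have h2 : ∑ w, M.coef v w * (1 - M.coef)⁻¹ w (ν j) =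
      ∑ i, M.coef v (ν i) * (1 - M.coef)⁻¹ (ν i) (ν j) := by
    refine (Finset.sum_subset (Finset.subset_univ (Finset.univ.map ⟨ν, h.inj⟩))
      fun w _ hw => ?_).symm.trans (Finset.sum_map _ _ _)
    by_contra hc
    obtain ⟨i, rfl⟩ := h.exists_node_of_edge (left_ne_zero_of_mul hc : Edge M.coef w v)
    exact hw (by simp)
  have h3 : own R ν v j = r v * t j * (1 : Matrix V V ℝ) v (ν j) := by
    by_cases hj : ν j = v
    · subst hj
      simp [own, h.apply_eq, M.causalOrder.inv_apply_self]
    · simp [own, hj, Matrix.one_apply_ne (Ne.symm hj)]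
  rw [Pi.sub_apply, h3, h.apply_eq, h1, h2, mul_add, add_sub_cancel_left, Finset.mul_sum,
    Finset.sum_apply]
  refine Finset.sum_congr rfl fun i _ => ?_
  rw [Pi.smul_apply, smul_eq_mul, h.apply_eq]
  field_simp [h.row_ne (ν i)]

theorem mem (v : V) : R v - own R ν v ∈ rowSpan R ν (M.parentIdx ν v) := by
  rw [h.sub_own_eq]
  refine sum_mem fun i _ => ?_
  by_cases hi : M.coef v (ν i) = 0
  · simp [hi]
  · exact smul_mem _ _ (mem_rowSpan (mem_parentIdx.2 (mem_pa.2 hi)))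

theorem mem_of_uLeaf {v : V} (hv : M.ULeaf v) : R v ∈ rowSpan R ν (M.parentIdx ν v) := by
  simpa [own_of_notMem ((h.uLeaf_iff v).1 hv)] using h.mem v

theorem faithfulA_iff :
    M.FaithfulA ↔ ∀ v, ∀ i ∈ M.parentIdx ν v, ∀ j, R (ν i) j ≠ 0 → R v j ≠ 0 := by
  constructor
  · intro hA v i hi j hj
    have h1 := mem_pa.1 (mem_parentIdx.1 hi)
    rw [h.apply_ne_zero_iff]
    apply hA
    rw [h.apply_ne_zero_iff, M.causalOrder.totalEffect_eq] at hj
    rw [mem_an]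
    rcases M.causalOrder.eq_or_transGen hj with e | e
    · exact e ▸ .single h1
    · exact e.tail h1
  · intro hA i j hij
    rw [mem_an] at hij
    induction hij with
    | single hi =>
      obtain ⟨a, rfl⟩ := h.exists_node_of_edge hi
      rw [← h.apply_ne_zero_iff]
      exact hA _ a (mem_parentIdx.2 (mem_pa.2 hi)) a (h.diag a)
    | tail h1 h2 ih =>
      obtain ⟨b, rfl⟩ := h.exists_node_of_edge h2
      obtain ⟨c, hc, -⟩ := Relation.TransGen.head'_iff.1 h1
      obtain ⟨a, rfl⟩ := h.exists_node_of_edge hc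
      rw [← h.apply_ne_zero_iff] at ih ⊢
      exact hA _ b (mem_parentIdx.2 (mem_pa.2 h2)) a ih

omit [Fintype ι] in
theorem node_mem_an_iff (hA : M.FaithfulA) {v : V} {i : ι} :
    ν i ∈ an M.coef v ↔ R v i ≠ 0 ∧ ν i ≠ v := by
  rw [h.apply_ne_zero_iff]
  constructor
  · exact fun hi => ⟨hA _ _ hi, M.causalOrder.ne_of_transGen (mem_an.1 hi)⟩
  · rintro ⟨h1, h2⟩
    rw [M.causalOrder.totalEffect_eq] at h1
    exact mem_an.2 ((M.causalOrder.eq_or_transGen h1).resolve_left h2)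

omit [Fintype ι] in
theorem exists_node_of_mem_an {v w : V} (hw : w ∈ an M.coef v) : ∃ i, ν i = w := by
  obtain ⟨c, hc, -⟩ := Relation.TransGen.head'_iff.1 (mem_an.1 hw)
  exact h.exists_node_of_edge hc

omit [Fintype ι] in
theorem mem_possiblePa_iff (hA : M.FaithfulA) {v w : V} :
    w ∈ M.possiblePa v ↔ PossPa R ν v w := by
  simp only [possiblePa, Finset.mem_filter, Finset.mem_univ, true_and, PossPa,
    ← h.node_mem_an_iff hA]
  refine and_congr_right fun hwv => ⟨?_, fun hs => ?_⟩
  · intro hw j hj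
    by_cases hjw : ν j = w
    · rcases hw with hw | hw
      · rwa [hjw]
      · exact ((h.uLeaf_iff w).1 hw.1 j hjw).elim
    have hj' := mem_an.1 ((h.node_mem_an_iff hA).2 ⟨hj, hjw⟩)
    rw [mem_an]
    rcases hw with hw | ⟨-, hw⟩
    · exact hj'.trans (mem_an.1 hw)
    · obtain ⟨b, hb, hbw⟩ := Relation.TransGen.tail'_iff.1 hj'
      exact Relation.TransGen.trans_right hb (mem_an.1 (hw (mem_pa.2 hbw)))
  · by_cases hw : M.ULeaf w
    · refine Or.inr ⟨hw, fun q hq => ?_⟩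
      obtain ⟨a, rfl⟩ := h.exists_node_of_edge (mem_pa.1 hq)
      exact hs a ((h.node_mem_an_iff hA).1 (mem_an.2 (.single (mem_pa.1 hq)))).1
    · obtain ⟨a, rfl⟩ := (h.range w).1 hw
      exact Or.inl (hs a (h.diag a))

omit [Fintype ι] in
/-- Restricting the vectors of total effects to a set `S` of nu-leaf nodes loses nothing if the rows
in `T` are supported on `S`. -/
theorem TE_mem_span_iff {S : Finset V} (hS : ∀ w ∈ S, ∃ i, ν i = w) {T : Finset V} {v : V}
    {x : ι → ℝ} (hx : ∀ i, ν i ∈ S → x i = R v i) (hx' : ∀ i, ν i ∉ S → x i = 0)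
    (hT : ∀ w ∈ T, ∀ i, ν i ∉ S → R w i = 0) :
    TE M.coef S v ∈ span ℝ ((fun w => TE M.coef S w) '' (T : Set V)) ↔
      x ∈ span ℝ (R '' (T : Set V)) := by
  rw [mem_span_image_finset_iff_exists_fun', mem_span_image_finset_iff_exists_fun']
  have hR : ∀ w i, R w i = r w * t i * totalEffect M.coef (ν i) w := fun w i => by
    rw [h.apply_eq, M.causalOrder.totalEffect_eq]
  constructor
  · rintro ⟨c, hc⟩
    refine ⟨fun w => r v * c w / r w, ?_⟩
    ext i
    rw [Finset.sum_apply]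
    by_cases hi : ν i ∈ S
    · have h1 := congrFun hc ⟨ν i, hi⟩
      simp only [Finset.sum_apply, Pi.smul_apply, smul_eq_mul, TE] at h1
      rw [hx i hi, hR v, ← h1, Finset.mul_sum]
      refine Finset.sum_congr rfl fun w _ => ?_
      rw [Pi.smul_apply, smul_eq_mul, hR w]
      field_simp [h.row_ne w]
    · rw [hx' i hi]
      refine Finset.sum_eq_zero fun w hw => ?_
      simp [hT w hw i hi]
  · rintro ⟨c, hc⟩
    refine ⟨fun w => c w * r w / r v, ?_⟩
    ext ⟨w, hw⟩
    obtain ⟨i, rfl⟩ := hS w hw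
    have h1 := congrFun hc i
    rw [hx i hw, hR v] at h1
    simp only [Finset.sum_apply, Pi.smul_apply, smul_eq_mul, TE] at h1 ⊢
    refine mul_left_cancel₀ (mul_ne_zero (h.row_ne v) (h.col_ne i)) ?_
    rw [← h1, Finset.mul_sum]
    refine Finset.sum_congr rfl fun w _ => ?_
    rw [hR w]
    field_simp [h.row_ne v]

omit [Fintype ι] in
theorem TE_an_mem_span_iff (hA : M.FaithfulA) {v : V} {T : Finset V} (hT : T ⊆ M.possiblePa v) :
    TE M.coef (an M.coef v) v ∈ span ℝ ((fun w => TE M.coef (an M.coef v) w) '' (T : Set V)) ↔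
      R v - own R ν v ∈ span ℝ (R '' (T : Set V)) := by
  refine h.TE_mem_span_iff (fun w hw => h.exists_node_of_mem_an hw) (fun i hi => ?_)
    (fun i hi => ?_) fun w hw i hi => ?_
  · simp [own, ((h.node_mem_an_iff hA).1 hi).2]
  · rw [h.node_mem_an_iff hA] at hi
    by_cases hv : ν i = v
    · simp [own, hv]
    · simp [own, hv, not_not.1 fun h0 => hi ⟨h0, hv⟩]
  · by_contra h0
    exact hi ((h.node_mem_an_iff hA).2 (((h.mem_possiblePa_iff hA).1 (hT hw)).2 i h0))

omit [Fintype ι] in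
theorem TE_an_sdiff_mem_span_iff [DecidableEq ι] (hA : M.FaithfulA) {u : V} (hu : M.ULeaf u)
    {x : ι} (hx : ν x ∈ pa M.coef u)
    {T : Finset V} (hT : T ⊆ M.possiblePa (ν x)) :
    TE M.coef (an M.coef u \ {ν x}) u ∈
        span ℝ ((fun w => TE M.coef (an M.coef u \ {ν x}) w) '' (T : Set V)) ↔
      R u - Pi.single x (R u x) ∈ span ℝ (R '' (T : Set V)) := by
  refine h.TE_mem_span_iff (fun w hw => h.exists_node_of_mem_an (Finset.mem_sdiff.1 hw).1)
    (fun i hi => ?_) (fun i hi => ?_) fun w hw i hi => ?_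
  · have hix : i ≠ x := by
      rintro rfl
      simp at hi
    simp [hix]
  · by_cases hix : i = x
    · simp [hix]
    · have h1 : ν i ∉ an M.coef u := fun hc => hi (by simp [hc, h.inj.eq_iff, hix])
      rw [h.node_mem_an_iff hA] at h1
      simpa [hix, (h.uLeaf_iff u).1 hu i] using h1
  · by_contra h0
    have h1 := (h.node_mem_an_iff hA).2 (((h.mem_possiblePa_iff hA).1 (hT hw)).2 i h0)
    refine hi (Finset.mem_sdiff.2 ⟨?_, ?_⟩)
    · exact mem_an.2 ((mem_an.1 h1).tail (mem_pa.1 hx))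
    · simpa using ((h.node_mem_an_iff hA).1 h1).2

end Presents

end SEMME

namespace SEMME

open Diagram Submodule RowModel

variable {V ι : Type*} [Fintype V] [DecidableEq V] [Fintype ι] [DecidableEq ι]

namespace Presents

variable {M : SEMME V} {R : V → ι → ℝ} {ν : ι → V} {r : V → ℝ} {t : ι → ℝ}
  (h : Presents M R ν r t)

include h

theorem linearIndependent : LinearIndependent ℝ fun i => R (ν i) :=
  linearIndependent_nodes h.inj h.diag h.mem

/-- In the equality cases of (b1) and (b2) the representation is minimal, so that the conclusion
extends from the u-leaf nodes to the nu-leaf nodes. -/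
theorem rowFaithful (hM : M.Faithful) : RowFaithful R ν (M.parentIdx ν) := by
  obtain ⟨hA, hB1, hB2⟩ := hM
  have hpp : ∀ {v : V} {T : Finset V}, (∀ w ∈ T, PossPa R ν v w) → T ⊆ M.possiblePa v :=
    fun hT w hw => (h.mem_possiblePa_iff hA).2 (hT w hw)
  refine ⟨h.inj, h.diag, h.mem, ?_, h.faithfulA_iff.1 hA, fun v T hT hcard hm => ?_,
    fun u hu x hx T hT hcard hm => ?_⟩
  · obtain ⟨r, -, hr⟩ := M.causalOrder
    exact ⟨r, fun v i hi => hr _ _ (mem_pa.1 (mem_parentIdx.1 hi))⟩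
  · rw [h.card_parentIdx] at hcard ⊢
    have key := hB1 v T (hpp hT) hcard ((h.TE_an_mem_span_iff hA (hpp hT)).2 hm)
    refine ⟨key.1, mem_rowSpan_of_minimal h.linearIndependent (h.mem v) hm (fun w hw hc => ?_)
      fun w hw hl => ?_⟩
    · have hT' := (Finset.erase_subset w T).trans (hpp hT)
      have hlt := Finset.card_erase_lt_of_mem hw
      have := (hB1 v (T.erase w) hT' (hlt.le.trans hcard) ((h.TE_an_mem_span_iff hA hT').2 hc)).1
      omega
    · have hl' := (h.uLeaf_iff w).2 hl
      exact rowSpan_mono ((h.parentIdx_subset_iff _ _).2 (key.2 w hw hl')) (h.mem_of_uLeaf hl')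
  · rw [h.card_union_parentIdx] at hcard ⊢
    have hu' := (h.uLeaf_iff u).2 hu
    have hx' := mem_parentIdx.1 hx
    have key := hB2 u hu' (ν x) hx' T (hpp hT) hcard
      ((h.TE_an_sdiff_mem_span_iff hA hu' hx' (hpp hT)).2 hm)
    have hy : R u - Pi.single x (R u x) ∈
        rowSpan R ν (M.parentIdx ν (ν x) ∪ M.parentIdx ν u) := by
      have h1 := rowSpan_mono (Q' := M.parentIdx ν (ν x) ∪ M.parentIdx ν u)
        Finset.subset_union_left (h.mem (ν x))
      have h2 := rowSpan_mono (Q' := M.parentIdx ν (ν x) ∪ M.parentIdx ν u)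
        Finset.subset_union_right (h.mem_of_uLeaf hu')
      have h3 : R (ν x) ∈ rowSpan R ν (M.parentIdx ν (ν x) ∪ M.parentIdx ν u) :=
        mem_rowSpan (Finset.mem_union_right _ hx)
      rw [own_node h.inj] at h1
      have h4 := smul_mem _ (R u x / R (ν x) x) (sub_mem h3 h1)
      rw [sub_sub_cancel, ← Pi.single_smul, smul_eq_mul, div_mul_cancel₀ _ (h.diag x)] at h4
      exact sub_mem h2 h4
    refine ⟨key.1, mem_rowSpan_of_minimal h.linearIndependent hy hm (fun w hw hc => ?_)
      fun w hw hl => ?_⟩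
    · have hT' := (Finset.erase_subset w T).trans (hpp hT)
      have hlt := Finset.card_erase_lt_of_mem hw
      have := (hB2 u hu' (ν x) hx' (T.erase w) hT' (by omega)
        ((h.TE_an_sdiff_mem_span_iff hA hu' hx' hT').2 hc)).1
      omega
    · have hl' := (h.uLeaf_iff w).2 hl
      exact rowSpan_mono ((h.parentIdx_subset_union_iff _ _ _).2 (key.2 w hw hl'))
        (h.mem_of_uLeaf hl')

theorem faithful (hR : RowFaithful R ν (M.parentIdx ν)) : M.Faithful := by
  have hA : M.FaithfulA := h.faithfulA_iff.2 hR.trans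
  refine ⟨hA, fun v T hT hcard hm => ?_, fun u hu v hv T hT hcard hm => ?_⟩
  · rw [← h.card_parentIdx] at hcard ⊢
    obtain ⟨h1, h2⟩ := hR.indep v T (fun w hw => (h.mem_possiblePa_iff hA).1 (hT hw)) hcard
      ((h.TE_an_mem_span_iff hA hT).1 hm)
    refine ⟨h1, fun l hl hl' => ?_⟩
    rw [← h.parentIdx_subset_iff, ← hR.parents_subset_iff ((h.uLeaf_iff l).1 hl')]
    exact h2 l hl
  · obtain ⟨x, rfl⟩ := h.exists_node_of_edge (mem_pa.1 hv)
    rw [← h.card_union_parentIdx] at hcard ⊢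
    obtain ⟨h1, h2⟩ := hR.indep' u ((h.uLeaf_iff u).1 hu) x (mem_parentIdx.2 hv) T
      (fun w hw => (h.mem_possiblePa_iff hA).1 (hT hw)) hcard
      ((h.TE_an_sdiff_mem_span_iff hA hu hv hT).1 hm)
    refine ⟨h1, fun l hl hl' => ?_⟩
    rw [← h.parentIdx_subset_union_iff, ← hR.parents_subset_iff ((h.uLeaf_iff l).1 hl')]
    exact h2 l hl

end Presents

/-- Faithful rows come from a faithful model, with any scaling `r` of the variables and any set of
observed variables that makes the `ν i` the nu-leaf nodes. -/
theorem exists_presents {R : V → ι → ℝ} {ν : ι → V} {p : V → Finset ι} (hR : RowFaithful R ν p)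
    {obs : Set V} (h1 : ∀ v ∈ obs, ∃ i, ν i = v) (h2 : ∀ i, ν i ∈ obs ∨ ∃ w, i ∈ p w)
    {r : V → ℝ} (hr : ∀ v, r v ≠ 0) :
    ∃ M : SEMME V, M.observed = obs ∧ M.parentIdx ν = p ∧
      Presents M R ν r fun i => R (ν i) i / r (ν i) := by
  obtain ⟨k, hk, hkR⟩ := hR.exists_weights
  let K : Matrix V V ℝ := fun v w => ∑ i, if ν i = w then k v i * r (ν i) / r v else 0
  have hKν : ∀ v i, K v (ν i) = k v i * r (ν i) / r v := by
    intro v i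
    simp [K, hR.inj.eq_iff]
  have hK0 : ∀ v w, (∀ i, ν i ≠ w) → K v w = 0 := by
    intro v w hw
    simp [K, hw]
  have hedge : ∀ v i, Edge K (ν i) v ↔ i ∈ p v := by
    intro v i
    rw [Edge, hKν, ← hk]
    simp [hr]
  have hnode : ∀ v w, Edge K w v → ∃ i, ν i = w := by
    intro v w hvw
    by_contra! hc
    exact hvw (hK0 v w hc)
  have hord : HasCausalOrder K := by
    obtain ⟨s, hs⟩ := hR.acyclic
    refine hasCausalOrder_of_lt (r := s) fun j i hji => ?_
    obtain ⟨a, rfl⟩ := hnode i j hji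
    exact hs i a ((hedge i a).1 hji)
  refine ⟨⟨K, obs, hord⟩, rfl, ?_, hR.inj, fun v => ?_, hr,
    fun i => div_ne_zero (hR.diag i) (hr _), fun v j => ?_⟩
  · ext v i
    rw [mem_parentIdx, mem_pa]
    exact hedge v i
  · constructor
    · intro hv
      by_contra! hc
      exact hv ⟨fun ho => by obtain ⟨i, hi⟩ := h1 v ho; exact hc i hi,
        fun w hw => by obtain ⟨i, hi⟩ := hnode w v hw; exact hc i hi⟩
    · rintro ⟨i, rfl⟩ ⟨ho, hch⟩
      rcases h2 i with hi | ⟨w, hw⟩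
      · exact ho hi
      · exact hch w ((hedge w i).2 hw)
  · have key := hord.eq_mul_inv_apply (x := fun v => R v j / r v) (a := R (ν j) j / r (ν j))
      (j := ν j) (fun v => ?_) v
    · rw [mul_assoc, ← key]
      field_simp [hr v]
    · have h3 := congrFun (hkR v) j
      rw [Pi.sub_apply, sub_eq_iff_eq_add'] at h3
      have h4 : ∑ w, K v w * (R w j / r w) = ∑ i, K v (ν i) * (R (ν i) j / r (ν i)) := by
        refine (Finset.sum_subset (Finset.subset_univ (Finset.univ.map ⟨ν, hR.inj⟩))
          fun w _ hw => ?_).symm.trans (Finset.sum_map _ _ _)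
        rw [hK0 v w fun i hi => hw (by simp [← hi]), zero_mul]
      have h5 : ∑ i, K v (ν i) * (R (ν i) j / r (ν i)) = (∑ i, k v i • R (ν i)) j / r v := by
        rw [Finset.sum_apply, Finset.sum_div]
        refine Finset.sum_congr rfl fun i _ => ?_
        rw [hKν, Pi.smul_apply, smul_eq_mul]
        field_simp [hr (ν i)]
      rw [h4, h5, h3, add_div]
      congr 1
      by_cases hv : v = ν j
      · simp [own, hv]
      · simp [own, hv, Ne.symm hv]

/-! ### Direct ordered groups -/

theorem mem_group_iff (M : SEMME V) {v l : V} :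
    l ∈ M.group v ↔ l = v ∨ (M.ULeaf l ∧ Edge M.coef v l ∧ ¬ M.EdgeId v l) := by
  simp [group]

theorem not_edgeId_iff (M : SEMME V) {v l : V} :
    ¬ M.EdgeId v l ↔ pa M.coef l \ {v} ⊆ pa M.coef v ∧
      ∀ k, Edge M.coef v k → pa M.coef l ⊆ pa M.coef k := by
  simp only [EdgeId, not_or, not_not, not_exists, not_and, Finset.mem_sdiff, mem_ch,
    Finset.mem_singleton]
  refine and_congr_right fun _ => ⟨fun h k hk => ?_, fun h k hk => h k hk.1⟩
  by_cases hkl : k = l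
  · rw [hkl]
  · exact h k ⟨hk, hkl⟩

/-- The members of the group of `ν i` are the variables that may take over its noise term. -/
theorem Presents.mem_group_node_iff {M : SEMME V} {R : V → ι → ℝ} {ν : ι → V} {r : V → ℝ}
    {t : ι → ℝ} (h : Presents M R ν r t) {i : ι} {l : V} :
    l ∈ M.group (ν i) ↔ l = ν i ∨ Exchangeable ν (M.parentIdx ν) i l := by
  rw [mem_group_iff, not_edgeId_iff]
  refine or_congr_right ?_
  have hsub : pa M.coef l \ {ν i} ⊆ pa M.coef (ν i) ↔
      M.parentIdx ν l ⊆ insert i (M.parentIdx ν (ν i)) := by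
    rw [← h.map_parentIdx, ← h.map_parentIdx (ν i)]
    constructor
    · intro hs j hj
      by_cases hji : j = i
      · simp [hji]
      · have := @hs (ν j) (by simp [h.inj.eq_iff, hj, hji])
        simp only [Finset.mem_map, Function.Embedding.coeFn_mk, h.inj.eq_iff] at this
        simpa using Or.inr this
    · intro hs x hx
      simp only [Finset.mem_sdiff, Finset.mem_map, Function.Embedding.coeFn_mk,
        Finset.mem_singleton] at hx ⊢
      obtain ⟨⟨j, hj, rfl⟩, hji⟩ := hx
      exact ⟨j, (Finset.mem_insert.1 (hs hj)).resolve_left fun e => hji (by rw [e]), rfl⟩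
  rw [h.uLeaf_iff, edge_node_iff, hsub]
  have hcl : (∀ k, Edge M.coef (ν i) k → pa M.coef l ⊆ pa M.coef k) ↔
      ∀ w, i ∈ M.parentIdx ν w → M.parentIdx ν l ⊆ M.parentIdx ν w := by
    simp only [edge_node_iff, h.parentIdx_subset_iff]
  rw [hcl]
  exact ⟨fun ⟨a, b, c, d⟩ => ⟨a, b, c, d⟩, fun ⟨a, b, c, d⟩ => ⟨a, b, c, d⟩⟩

end SEMME

namespace SEMME

open Diagram RowModel

variable {V ι : Type*} [Fintype V] [DecidableEq V]

namespace Presents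

variable {M : SEMME V} {R : V → ι → ℝ} {ν : ι → V} {r : V → ℝ} {t : ι → ℝ}

variable [Fintype ι]

theorem dog_eq (h : Presents M R ν r t) :
    M.dog = Finset.univ.image (fun i => M.group (ν i)) ∪
      (Finset.univ.filter fun l => ∀ i, l ∉ M.group (ν i)).image ({·}) := by
  ext G
  simp only [dog, Finset.mem_union, Finset.mem_image, Finset.mem_filter, Finset.mem_univ, true_and]
  refine or_congr ⟨?_, ?_⟩ (exists_congr fun l => and_congr_left fun _ => ⟨?_, fun hl => ?_⟩)
  · rintro ⟨v, hv, rfl⟩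
    obtain ⟨i, rfl⟩ := (h.range v).1 hv
    exact ⟨i, rfl⟩
  · rintro ⟨i, rfl⟩
    exact ⟨ν i, (h.range _).2 ⟨i, rfl⟩, rfl⟩
  · rintro ⟨hl, hid⟩ i hi
    rcases (M.mem_group_iff).1 hi with rfl | ⟨-, he, hn⟩
    · exact (h.uLeaf_iff _).1 hl i rfl
    · exact hn (hid _ ((h.range _).2 ⟨i, rfl⟩) he)
  · have hu : M.ULeaf l :=
      (h.uLeaf_iff l).2 fun i hi => hl i ((M.mem_group_iff).2 (Or.inl hi.symm))
    refine ⟨hu, fun v hv he => ?_⟩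
    obtain ⟨i, rfl⟩ := (h.range v).1 hv
    by_contra hn
    exact hl i ((M.mem_group_iff).2 (Or.inr ⟨hu, he, hn⟩))

/-- A model is determined by its rows, including their scaling, and its nu-leaf nodes. -/
theorem coef_unique {M' : SEMME V} {t' : ι → ℝ} (h : Presents M R ν r t)
    (h' : Presents M' R ν r t') : M.coef = M'.coef := by
  have hcol : ∀ v j, (1 - M.coef)⁻¹ v j = (1 - M'.coef)⁻¹ v j := by
    intro v j
    by_cases hj : ∃ i, ν i = j
    · obtain ⟨i, rfl⟩ := hj
      have h1 := fun w => (h.apply_eq w i).symm.trans (h'.apply_eq w i)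
      have h2 := h1 (ν i)
      rw [M.causalOrder.inv_apply_self, M'.causalOrder.inv_apply_self, mul_one, mul_one] at h2
      have h3 := h1 v
      rw [mul_left_cancel₀ (h.row_ne _) h2] at h3
      exact mul_left_cancel₀ (mul_ne_zero (h.row_ne v) (h'.col_ne i)) h3
    · -- a u-leaf node has no effect on other variables
      have hleaf : ∀ {N : SEMME V}, N.ULeaf j → (1 - N.coef)⁻¹ v j = (1 : Matrix V V ℝ) v j := by
        intro N hN
        rw [N.causalOrder.inv_apply, add_eq_left]
        refine Finset.sum_eq_zero fun w _ => ?_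
        by_contra hc
        rcases N.causalOrder.eq_or_transGen (right_ne_zero_of_mul hc) with rfl | h1
        · exact hN.2 v (left_ne_zero_of_mul hc)
        · obtain ⟨b, hb, -⟩ := Relation.TransGen.head'_iff.1 h1
          exact hN.2 b hb
      push Not at hj
      rw [hleaf ((h.uLeaf_iff j).2 hj), hleaf ((h'.uLeaf_iff j).2 hj)]
  have h1 : (1 - M.coef)⁻¹ = (1 - M'.coef)⁻¹ := by
    ext v j
    exact hcol v j
  have h2 := Matrix.inv_inj h1 M.causalOrder.isUnit_det
  exact sub_right_injective h2

variable [DecidableEq ι]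

theorem group_disjoint (h : Presents M R ν r t) (hM : M.Faithful) {i j : ι} {l : V}
    (hi : l ∈ M.group (ν i)) (hj : l ∈ M.group (ν j)) : i = j := by
  rw [h.mem_group_node_iff] at hi hj
  rcases hi with rfl | hi
  · rcases hj with hj | hj
    · exact h.inj hj
    · exact (hj.notMem i rfl).elim
  · rcases hj with rfl | hj
    · exact (hi.notMem j rfl).elim
    · exact (h.rowFaithful hM).exchangeable_unique hi hj

theorem prod_dog (h : Presents M R ν r t) (hM : M.Faithful) {f : Finset V → ℕ}
    (hf : ∀ l, f {l} = 1) : ∏ G ∈ M.dog, f G = ∏ i, f (M.group (ν i)) := by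
  have hself : ∀ i, ν i ∈ M.group (ν i) := fun i => (M.mem_group_iff).2 (Or.inl rfl)
  rw [h.dog_eq, Finset.prod_union, Finset.prod_image, Finset.prod_image, Finset.prod_congr rfl
    fun l _ => hf l, Finset.prod_const_one, mul_one]
  · simp
  · intro i _ j _ hij
    exact h.group_disjoint hM (hself i) (by simpa only [← hij] using hself i)
  · rw [Finset.disjoint_left]
    simp only [Finset.mem_image, Finset.mem_filter, Finset.mem_univ, true_and, not_exists, not_and]
    rintro _ ⟨i, rfl⟩ l hl hlG
    exact hl i (by simp [← hlG])

/-- Two faithful models with the same rows attach each noise term to members of the same group. -/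
theorem mem_group (h : Presents M R ν r t) (hM : M.Faithful) {ν' : ι → V} {p' : V → Finset ι}
    (h' : RowFaithful R ν' p') (i : ι) : ν' i ∈ M.group (ν i) := by
  rw [h.mem_group_node_iff]
  by_cases hi : ν' i = ν i
  · exact Or.inl hi
  · exact Or.inr ((h.rowFaithful hM).exchangeable_of_ne h' hi)

theorem exchangeable_of_mem_group (h : Presents M R ν r t) {i : ι} {l : V}
    (hl : l ∈ M.group (ν i)) (hne : l ≠ ν i) : Exchangeable ν (M.parentIdx ν) i l :=
  (h.mem_group_node_iff.1 hl).resolve_left hne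

/-- If each noise term is attached to a member `c i` of the group of `ν i`, there is a faithful
model with these nu-leaf nodes, the same rows and the same groups. -/
theorem exists_choice (h : Presents M R ν r t) (hM : M.Faithful) {c : ι → V}
    (hc : ∀ i, c i ∈ M.group (ν i)) :
    ∃ M' : SEMME V, M'.Faithful ∧ (∃ t', Presents M' R c r t') ∧
      (∀ i, M'.group (c i) = M.group (ν i)) ∧
      ((∀ i, ν i ∈ M.observed → c i = ν i) → M'.observed = M.observed) := by
  have hR := h.rowFaithful hM
  have hce := fun i (hi : c i ≠ ν i) => h.exchangeable_of_mem_group (hc i) hi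
  obtain ⟨σ, hσ⟩ := hR.exists_isExchange hce
  have hR' := hR.exchange hce hσ
  obtain ⟨M', hobs, hp, h'⟩ := exists_presents hR' (obs := {v | σ v ∈ M.observed})
    (fun v hv => by
      obtain ⟨i, hi⟩ := (h.range (σ v)).1 fun hu => hu.1 hv
      exact ⟨i, hσ.node_eq_iff.1 hi⟩)
    (fun i => by
      by_contra! hcon
      simp only [Set.mem_ofPred_eq, hσ.choice] at hcon
      refine (h.range (ν i)).2 ⟨i, rfl⟩ ⟨hcon.1, fun w hw => hcon.2 (σ w) ?_⟩
      rw [hσ.invol]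
      exact edge_node_iff.1 hw) h.row_ne
  have hM' : M'.Faithful := h'.faithful (hp ▸ hR')
  refine ⟨M', hM', ⟨_, h'⟩, fun i => ?_, fun hfix => ?_⟩
  · have hmem : ∀ l, l ∈ M'.group (c i) ↔ σ l ∈ M.group (ν i) := by
      intro l
      rw [h'.mem_group_node_iff, h.mem_group_node_iff, hp, hσ.exchangeable_iff,
        eq_comm (a := l), ← hσ.node_eq_iff, eq_comm (a := σ l)]
    have hself : ν i ∈ M.group (ν i) := (M.mem_group_iff).2 (Or.inl rfl)
    ext l
    rw [hmem]
    -- the exchange moves variables within their groups only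
    rcases hσ.cases l with ⟨hl, -⟩ | ⟨j, -, rfl | rfl⟩
    · rw [hl]
    · rw [hσ.choice]
      constructor
      · intro hj
        rw [← h.group_disjoint hM hj ((M.mem_group_iff).2 (Or.inl rfl))]
        exact hc _
      · intro hj
        rwa [← h.group_disjoint hM hj (hc j)]
    · rw [hσ.node]
      constructor
      · intro hj
        rwa [← h.group_disjoint hM hj (hc j)]
      · intro hj
        rw [← h.group_disjoint hM hj ((M.mem_group_iff).2 (Or.inl rfl))]
        exact hc _
  · rw [hobs]
    ext v
    simp only [Set.mem_ofPred_eq]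
    rcases hσ.cases v with ⟨hv, -⟩ | ⟨j, hj, hv⟩
    · rw [hv]
    · -- neither `ν j` nor the leaf `c j` is observed
      have h1 : ν j ∉ M.observed := fun ho => hj (hfix j ho)
      have h2 : c j ∉ M.observed := ((h.uLeaf_iff _).2 (hce j hj).notMem).1
      rcases hv with rfl | rfl
      · rw [hσ.choice]
        exact iff_of_false h1 h2
      · rw [hσ.node]
        exact iff_of_false h2 h1

end Presents

/-- The nu-leaf node of a group has edges to all other members, so the diagram determines it. -/
theorem choice_unique {M M' : SEMME V} (hMM' : M.coef = M'.coef) {ν c c' : ι → V} {N : SEMME V}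
    (hc : ∀ i, c i ∈ N.group (ν i)) (hc' : ∀ i, c' i ∈ N.group (ν i))
    (hM : ∀ i, M.group (c i) = N.group (ν i)) (hM' : ∀ i, M'.group (c' i) = N.group (ν i)) :
    c = c' := by
  funext i
  by_contra hne
  have h1 := (M.mem_group_iff).1 (hM i ▸ hc' i)
  have h2 := (M'.mem_group_iff).1 (hM' i ▸ hc i)
  have h3 := (h1.resolve_left (Ne.symm hne)).2.1
  have h4 := (h2.resolve_left hne).2.1
  rw [← hMM'] at h4
  exact M.causalOrder.ne_of_transGen (.tail (.single h3) h4) rfl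

/-! ### Models with the same mixing matrix -/

theorem presents_mixing (M : SEMME V) :
    Presents M M.mixing Subtype.val (fun _ => 1) fun _ => 1 := by
  refine ⟨Subtype.val_injective, fun v => ?_, by simp, by simp, fun v i => by simp [mixing]⟩
  simp

/-- A model with the same mixing matrix attaches the noise terms of `M` to other variables `c i`. -/
theorem sameMixing_iff {M M' : SEMME V} :
    SameMixing M M' ↔ ∃ c t, Presents M' M.mixing c (fun _ => 1) t := by
  constructor
  · rintro ⟨e, t, ht, he⟩
    refine ⟨fun i => (e.symm i).1, fun i => (t (e.symm i))⁻¹,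
      Subtype.val_injective.comp e.symm.injective, fun v => ⟨fun hv => ?_, ?_⟩, by simp,
      fun i => inv_ne_zero (ht _), fun v i => ?_⟩
    · exact ⟨e ⟨v, hv⟩, by simp⟩
    · rintro ⟨i, rfl⟩
      exact (e.symm i).2
    · have h1 := he v (e.symm i)
      rw [e.apply_symm_apply] at h1
      rw [one_mul, eq_inv_mul_iff_mul_eq₀ (ht _), ← h1]
      rfl
  · rintro ⟨c, t, h⟩
    let f : {v // M.NULeaf v} → {v // M'.NULeaf v} := fun i => ⟨c i, (h.range _).2 ⟨i, rfl⟩⟩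
    have hf : Function.Bijective f := by
      refine ⟨fun i j hij => h.inj (congrArg Subtype.val hij), fun s => ?_⟩
      obtain ⟨i, hi⟩ := (h.range s.1).1 s.2
      exact ⟨i, Subtype.ext hi⟩
    let e := Equiv.ofBijective f hf
    refine ⟨e.symm, fun s => (t (e.symm s))⁻¹, fun s => inv_ne_zero (h.col_ne _), fun v s => ?_⟩
    have h1 := h.apply_eq v (e.symm s)
    have h2 : c (e.symm s) = s.1 := congrArg Subtype.val (e.apply_symm_apply s)
    rw [one_mul, h2] at h1
    rw [h1, inv_mul_cancel_left₀ (h.col_ne _)]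
    rfl

open Classical in
/-- The choices of one member in the group of each nu-leaf node. -/
noncomputable def choices (M : SEMME V) : Finset ({v // M.NULeaf v} → V) :=
  Fintype.piFinset fun i => M.group i.1

open Classical in
/-- The choices that select each observed variable. -/
noncomputable def choicesObs (M : SEMME V) : Finset ({v // M.NULeaf v} → V) :=
  Fintype.piFinset fun i => if i.1 ∈ M.observed then {i.1} else M.group i.1

theorem mem_choices {M : SEMME V} {c : {v // M.NULeaf v} → V} :
    c ∈ M.choices ↔ ∀ i, c i ∈ M.group i.1 := by
  simp [choices]

theorem mem_choicesObs {M : SEMME V} {c : {v // M.NULeaf v} → V} :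
    c ∈ M.choicesObs ↔ c ∈ M.choices ∧ ∀ i, i.1 ∈ M.observed → c i = i.1 := by
  simp only [choicesObs, Fintype.mem_piFinset, mem_choices, ← forall_and]
  refine forall_congr' fun i => ?_
  by_cases hi : i.1 ∈ M.observed
  · simp only [hi, if_true, Finset.mem_singleton, true_imp_iff]
    exact ⟨fun h => ⟨(M.mem_group_iff).2 (Or.inl h), h⟩, And.right⟩
  · simp [hi]

/-- Each choice `c` belongs to a model in the class, with nu-leaf nodes `c i`. -/
theorem exists_model_of_choices {M : SEMME V} (hM : M.Faithful) :
    ∃ F : ({v // M.NULeaf v} → V) → SEMME V, ∀ c ∈ M.choices, (F c).Faithful ∧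
      (∃ t, Presents (F c) M.mixing c (fun _ => 1) t) ∧ (∀ i, (F c).group (c i) = M.group i.1) ∧
      (c ∈ M.choicesObs → (F c).observed = M.observed) := by
  classical
  have h := M.presents_mixing
  have hex : ∀ c : {v // M.NULeaf v} → V, ∃ M' : SEMME V, c ∈ M.choices → M'.Faithful ∧
      (∃ t, Presents M' M.mixing c (fun _ => 1) t) ∧ (∀ i, M'.group (c i) = M.group i.1) ∧
      (c ∈ M.choicesObs → M'.observed = M.observed) := by
    intro c
    by_cases hc : c ∈ M.choices
    · obtain ⟨M', h1, h2, h3, h4⟩ := h.exists_choice hM (mem_choices.1 hc)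
      exact ⟨M', fun _ => ⟨h1, h2, h3, fun hco => h4 (mem_choicesObs.1 hco).2⟩⟩
    · exact ⟨M, fun hc' => (hc hc').elim⟩
  choose F hF using hex
  exact ⟨F, hF⟩

section Class

variable {M : SEMME V} (hM : M.Faithful) {F : ({v // M.NULeaf v} → V) → SEMME V}
  (hF : ∀ c ∈ M.choices, (F c).Faithful ∧
    (∃ t, Presents (F c) M.mixing c (fun _ => 1) t) ∧ (∀ i, (F c).group (c i) = M.group i.1) ∧
    (c ∈ M.choicesObs → (F c).observed = M.observed))

include hM in
theorem mem_choices_of_presents {M' : SEMME V} (hM' : M'.Faithful) {c : {v // M.NULeaf v} → V}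
    {t : {v // M.NULeaf v} → ℝ} (h : Presents M' M.mixing c (fun _ => 1) t) : c ∈ M.choices := by
  classical
  exact mem_choices.2 (M.presents_mixing.mem_group hM (h.rowFaithful hM'))

include hM in
theorem mem_choicesObs_of_presents {M' : SEMME V} (hM' : M'.Faithful)
    (hobs : M'.observed = M.observed) {c : {v // M.NULeaf v} → V}
    {t : {v // M.NULeaf v} → ℝ} (h : Presents M' M.mixing c (fun _ => 1) t) :
    c ∈ M.choicesObs := by
  classical
  have hc := mem_choices_of_presents hM hM' h
  refine mem_choicesObs.2 ⟨hc, fun i hi => ?_⟩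
  -- an observed variable is a nu-leaf node of the other model as well
  obtain ⟨j, hj⟩ := (h.range i.1).1 fun hu => hu.1 (hobs ▸ hi)
  have h1 : i.1 ∈ M.group j.1 := hj ▸ mem_choices.1 hc j
  have h2 : i.1 ∈ M.group i.1 := (M.mem_group_iff).2 (Or.inl rfl)
  rw [← hj, M.presents_mixing.group_disjoint hM h1 h2]

include hF in
theorem mem_dogClass_of_choices {c : {v // M.NULeaf v} → V} (hc : c ∈ M.choices) :
    F c ∈ M.dogClass := by
  classical
  obtain ⟨h1, ⟨t, h2⟩, h3, -⟩ := hF c hc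
  refine ⟨h1, sameMixing_iff.2 ⟨c, t, h2⟩, ?_⟩
  rw [h2.dog_eq, M.presents_mixing.dog_eq]
  simp only [h3]

include hF in
theorem injOn_coef_choices : Set.InjOn (fun c => (F c).coef) (M.choices : Set _) := by
  intro c hc c' hc' he
  exact choice_unique (N := M) (ν := Subtype.val) he (mem_choices.1 hc) (mem_choices.1 hc')
    (hF c hc).2.2.1 (hF c' hc').2.2.1

include hF in
theorem coef_eq_of_presents {M' : SEMME V} {c : {v // M.NULeaf v} → V} (hc : c ∈ M.choices)
    {t : {v // M.NULeaf v} → ℝ} (h : Presents M' M.mixing c (fun _ => 1) t) :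
    M'.coef = (F c).coef := by
  classical
  obtain ⟨-, ⟨t', h'⟩, -⟩ := hF c hc
  exact h.coef_unique h'

include hM hF

theorem coef_image_dogClass : coef '' M.dogClass =
    (fun c => (F c).coef) '' (M.choices : Set _) := by
  classical
  ext K
  constructor
  · rintro ⟨M', ⟨h1, h2, -⟩, rfl⟩
    obtain ⟨c, t, h⟩ := sameMixing_iff.1 h2
    have hc := mem_choices_of_presents hM h1 h
    exact ⟨c, hc, (coef_eq_of_presents hF hc h).symm⟩
  · rintro ⟨c, hc, rfl⟩
    exact ⟨F c, mem_dogClass_of_choices hF hc, rfl⟩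

theorem dogClass_observed :
    {M' ∈ M.dogClass | M'.observed = M.observed} = F '' (M.choicesObs : Set _) := by
  ext M'
  constructor
  · rintro ⟨⟨h1, h2, -⟩, h3⟩
    obtain ⟨c, t, h⟩ := sameMixing_iff.1 h2
    have hc := mem_choicesObs_of_presents hM h1 h3 h
    have hc' := (mem_choicesObs.1 hc).1
    refine ⟨c, hc, SEMME.ext (coef_eq_of_presents hF hc' h).symm ?_⟩
    rw [(hF c hc').2.2.2 hc, h3]
  · rintro ⟨c, hc, rfl⟩
    have hc' := (mem_choicesObs.1 hc).1
    exact ⟨mem_dogClass_of_choices hF hc', (hF c hc').2.2.2 hc⟩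

end Class

theorem ncard_coef_dogClass {M : SEMME V} (hM : M.Faithful) :
    (coef '' M.dogClass).ncard = ∏ G ∈ M.dog, G.card := by
  classical
  obtain ⟨F, hF⟩ := exists_model_of_choices hM
  rw [coef_image_dogClass hM hF, (injOn_coef_choices hF).ncard_image,
    Set.ncard_coe_finset, choices, Fintype.card_piFinset,
    M.presents_mixing.prod_dog hM Finset.card_singleton]

theorem ncard_dogClass_observed {M : SEMME V} (hM : M.Faithful) {D : Finset (Finset V)}
    (hD : ∀ G, G ∈ D ↔ G ∈ M.dog ∧ ∀ v ∈ G, v ∉ M.observed) :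
    {M' ∈ M.dogClass | M'.observed = M.observed}.ncard = ∏ G ∈ D, G.card := by
  classical
  obtain ⟨F, hF⟩ := exists_model_of_choices hM
  have hinj : Set.InjOn F (M.choicesObs : Set _) := fun c hc c' hc' he =>
    injOn_coef_choices hF (mem_choicesObs.1 hc).1 (mem_choicesObs.1 hc').1 (congrArg coef he)
  have hD' : D = M.dog.filter fun G => ∀ v ∈ G, v ∉ M.observed := by
    ext G
    rw [hD, Finset.mem_filter]
  rw [dogClass_observed hM hF, hinj.ncard_image, Set.ncard_coe_finset, choicesObs,
    Fintype.card_piFinset, hD', Finset.prod_filter, M.presents_mixing.prod_dog hM (by simp)]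
  refine Finset.prod_congr rfl fun i _ => ?_
  -- the leaves in a group are not observed
  have hobs : (∀ v ∈ M.group i.1, v ∉ M.observed) ↔ i.1 ∉ M.observed := by
    refine ⟨fun h => h _ ((M.mem_group_iff).2 (Or.inl rfl)), fun h v hv => ?_⟩
    rcases (M.mem_group_iff).1 hv with rfl | hv
    · exact h
    · exact hv.1.1
  simp only [hobs]
  by_cases hi : i.1 ∈ M.observed
  · simp [hi]
  · simp [hi]

theorem group_eq_singleton {M : SEMME V} {v : V}
    (h : ∀ l, M.ULeaf l → Edge M.coef v l → M.EdgeId v l) {l : V} (hl : l ∈ M.group v) :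
    l = v := by
  rcases (M.mem_group_iff).1 hl with rfl | ⟨h1, h2, h3⟩
  · rfl
  · exact (h3 (h l h1 h2)).elim

theorem uniquelyIdentifiable_iff {M : SEMME V} (hM : M.Faithful) :
    M.UniquelyIdentifiable ↔
      ∀ v l, M.NULeaf v → M.ULeaf l → Edge M.coef v l → M.EdgeId v l := by
  classical
  constructor
  · intro hU v l hv hl he
    by_contra hn
    -- otherwise the models for two different choices have the diagram of `M`
    obtain ⟨F, hF⟩ := exists_model_of_choices hM
    have hcoef : ∀ c ∈ M.choices, (F c).coef = M.coef := fun c hc =>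
      hU _ (hF c hc).1 (mem_dogClass_of_choices hF hc).2.1
    have h0 : (Subtype.val : {v // M.NULeaf v} → V) ∈ M.choices :=
      mem_choices.2 fun i => (M.mem_group_iff).2 (Or.inl rfl)
    have h1 : Function.update Subtype.val ⟨v, hv⟩ l ∈ M.choices := by
      refine mem_choices.2 fun i => ?_
      by_cases hi : i = ⟨v, hv⟩
      · subst hi
        simpa using (M.mem_group_iff).2 (Or.inr ⟨hl, he, hn⟩)
      · simpa [hi] using (M.mem_group_iff).2 (Or.inl rfl)
    have h2 := congrFun (injOn_coef_choices hF h0 h1 ((hcoef _ h0).trans (hcoef _ h1).symm)) ⟨v, hv⟩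
    simp only [Function.update_self] at h2
    exact hv (h2 ▸ hl)
  · intro hid M' hM' hmix
    obtain ⟨c, t, h⟩ := sameMixing_iff.1 hmix
    have hc := mem_choices.1 (mem_choices_of_presents hM hM' h)
    have hcv : c = Subtype.val := funext fun i =>
      group_eq_singleton (fun l hl he => hid i.1 l i.2 hl he) (hc i)
    exact (hcv ▸ h).coef_unique M.presents_mixing

theorem uniquelyIdentifiableKnownObs_iff {M : SEMME V} (hM : M.Faithful) :
    M.UniquelyIdentifiableKnownObs ↔
      ∀ v l, M.NULeaf v → v ∉ M.observed → M.ULeaf l → Edge M.coef v l → M.EdgeId v l := by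
  classical
  constructor
  · intro hU v l hv hvo hl he
    by_contra hn
    obtain ⟨F, hF⟩ := exists_model_of_choices hM
    have hcoef : ∀ c ∈ M.choicesObs, F c = M := fun c hc =>
      have hc' := (mem_choicesObs.1 hc).1
      hU _ (hF c hc').1 (mem_dogClass_of_choices hF hc').2.1 ((hF c hc').2.2.2 hc)
    have h0 : (Subtype.val : {v // M.NULeaf v} → V) ∈ M.choicesObs :=
      mem_choicesObs.2 ⟨mem_choices.2 fun i => (M.mem_group_iff).2 (Or.inl rfl), fun _ _ => rfl⟩
    have h1 : Function.update Subtype.val ⟨v, hv⟩ l ∈ M.choicesObs := by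
      refine mem_choicesObs.2 ⟨mem_choices.2 fun i => ?_, fun i hio => ?_⟩
      · by_cases hi : i = ⟨v, hv⟩
        · subst hi
          simpa using (M.mem_group_iff).2 (Or.inr ⟨hl, he, hn⟩)
        · simpa [hi] using (M.mem_group_iff).2 (Or.inl rfl)
      · have hi : i ≠ ⟨v, hv⟩ := by
          rintro rfl
          exact hvo hio
        simp [hi]
    have h2 := congrFun (injOn_coef_choices hF (mem_choicesObs.1 h0).1 (mem_choicesObs.1 h1).1
      (congrArg coef ((hcoef _ h0).trans (hcoef _ h1).symm))) ⟨v, hv⟩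
    simp only [Function.update_self] at h2
    exact hv (h2 ▸ hl)
  · intro hid M' hM' hmix hobs
    obtain ⟨c, t, h⟩ := sameMixing_iff.1 hmix
    have hc := mem_choicesObs.1 (mem_choicesObs_of_presents hM hM' hobs h)
    have hcv : c = Subtype.val := by
      funext i
      by_cases hi : i.1 ∈ M.observed
      · exact hc.2 i hi
      · exact group_eq_singleton (fun l hl he => hid i.1 l i.2 hi hl he) (mem_choices.1 hc.1 i)
    exact SEMME.ext ((hcv ▸ h).coef_unique M.presents_mixing) hobs

end SEMME

/-! ### Reversing the edges of a model with unobserved roots -/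

namespace Diagram

variable {V : Type*} [Fintype V] (K : Matrix V V ℝ)

theorem pa_transpose (v : V) : pa Kᵀ v = ch K v := rfl

theorem an_transpose (v : V) : an Kᵀ v = de K v := by
  ext w
  rw [mem_an, mem_de]
  exact Relation.transGen_swap (r := Edge K)

variable [DecidableEq V]

theorem totalEffect_transpose (i j : V) : totalEffect Kᵀ i j = totalEffect K j i := by
  simp only [totalEffect, ← Matrix.transpose_pow, Matrix.transpose_apply]

theorem TE_transpose_mem_span_iff {S S' : Finset V} (hS : S = S') (T : Finset V) (v : V) :
    TE Kᵀ S v ∈ Submodule.span ℝ ((fun w => TE Kᵀ S w) '' (T : Set V)) ↔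
      TC K v S' ∈ Submodule.span ℝ ((fun w => TC K w S') '' (T : Set V)) := by
  subst hS
  have h : ∀ w, TE Kᵀ S w = TC K w S := fun w => funext fun _ => totalEffect_transpose K _ _
  simp only [h]

end Diagram

namespace SEMUR

open Diagram RowModel

variable {X H : Type*} [Fintype X] [Fintype H]

/-- Reversing the edges turns latent variables into u-leaf nodes and observed variables into nu-leaf
nodes. -/
noncomputable def dual (M : SEMUR X H) : SEMME (H ⊕ X) where
  coef := M.coefᵀ
  observed := Set.range Sum.inr
  causalOrder := by
    obtain ⟨r, -, hr⟩ := M.causalOrder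
    have hle : ∀ x, r x ≤ ∑ y, r y := fun x =>
      Finset.single_le_sum (f := r) (fun _ _ => Nat.zero_le _) (Finset.mem_univ x)
    refine hasCausalOrder_of_lt
      (r := Sum.elim (fun _ => ∑ y, r y + 1) fun x => ∑ y, r y - r x) fun j i hji => ?_
    rcases j with h | x
    · rcases i with h' | y <;> simp [Edge, coef] at hji
    · rcases i with h | y
      · simp only [Sum.elim_inl, Sum.elim_inr]
        omega
      · have h1 := hr y x hji
        have h2 := hle x
        simp only [Sum.elim_inr]
        omega

theorem dual_uLeaf_iff (M : SEMUR X H) (v : H ⊕ X) : M.dual.ULeaf v ↔ ∃ h, v = Sum.inl h := by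
  rcases v with h | x
  · simp only [Sum.inl.injEq, exists_eq', iff_true]
    refine ⟨by simp [dual], fun w hw => hw ?_⟩
    rcases w with h' | y <;> simp [dual, coef]
  · simp [SEMME.ULeaf, dual]

/-- Every SEM-ME in which the u-leaf nodes are the latent variables arises by reversing edges. -/
theorem exists_dual_eq {D : SEMME (H ⊕ X)} (hobs : D.observed = Set.range Sum.inr)
    (hleaf : ∀ h : H, D.ULeaf (Sum.inl h)) : ∃ M : SEMUR X H, M.dual = D := by
  obtain ⟨r, -, hr⟩ := D.causalOrder
  have hle : ∀ x : X, r (Sum.inr x) ≤ ∑ y, r (Sum.inr y) := fun x =>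
    Finset.single_le_sum (f := fun y => r (Sum.inr y)) (fun _ _ => Nat.zero_le _)
      (Finset.mem_univ x)
  refine ⟨⟨fun y x => D.coef (Sum.inr x) (Sum.inr y), fun y h => D.coef (Sum.inl h) (Sum.inr y),
    hasCausalOrder_of_lt (r := fun x => ∑ y, r (Sum.inr y) - r (Sum.inr x)) fun j i hji => ?_⟩, ?_⟩
  · have h1 := hr _ _ (show Edge D.coef (Sum.inr i) (Sum.inr j) from hji)
    have h2 := hle j
    show _ - _ < _ - _
    omega
  · refine SEMME.ext ?_ hobs.symm
    ext v w
    rcases w with h | y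
    · have h0 : D.coef v (Sum.inl h) = 0 := not_not.1 ((hleaf h).2 v)
      rw [h0]
      rcases v with h' | x <;> rfl
    · rcases v with h' | x <;> rfl

variable [DecidableEq X]

omit [Fintype H] in
theorem mixing_apply_inr (M : SEMUR X H) (x y : X) : M.mixing x (Sum.inr y) = (1 - M.A)⁻¹ x y := rfl

omit [Fintype H] in
theorem mixing_apply_inl (M : SEMUR X H) (x : X) (h : H) :
    M.mixing x (Sum.inl h) = ((1 - M.A)⁻¹ * M.B) x h := rfl

variable [DecidableEq H]

theorem dual_possiblePa (M : SEMUR X H) (v : H ⊕ X) : M.dual.possiblePa v = M.possibleCh v := by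
  ext w
  simp only [SEMME.possiblePa, possibleCh, Finset.mem_filter, Finset.mem_univ, true_and,
    dual_uLeaf_iff]
  simp only [dual, an_transpose, pa_transpose]

theorem dual_faithful_iff (M : SEMUR X H) : M.dual.Faithful ↔ M.Faithful := by
  refine and_congr ?_ (and_congr ?_ ?_)
  · simp only [SEMME.FaithfulA, FaithfulA, dual, an_transpose, totalEffect_transpose]
    exact forall_comm
  · simp only [SEMME.FaithfulB1, FaithfulB1, dual_possiblePa, dual_uLeaf_iff]
    refine forall_congr' fun v => forall_congr' fun T => imp_congr_right fun _ =>
      imp_congr_right fun _ =>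
        imp_congr (TE_transpose_mem_span_iff M.coef (an_transpose _ v) T v) ?_
    refine and_congr_right fun _ => ⟨fun h l hl => h _ hl ⟨l, rfl⟩, ?_⟩
    rintro h _ hl ⟨l, rfl⟩
    exact h l hl
  · simp only [SEMME.FaithfulB2, FaithfulB2, dual_possiblePa, dual_uLeaf_iff]
    have hspan := fun (l : H) (x : H ⊕ X) (T : Finset (H ⊕ X)) =>
      TE_transpose_mem_span_iff M.coef (S := an M.coefᵀ (Sum.inl l) \ {x})
        (S' := de M.coef (Sum.inl l) \ {x}) (by rw [an_transpose]) T (Sum.inl l)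
    constructor
    · intro h l x hx T hT hcard hm
      obtain ⟨h1, h2⟩ := h _ ⟨l, rfl⟩ x hx T hT hcard ((hspan l x T).2 hm)
      exact ⟨h1, fun k hk => h2 _ hk ⟨k, rfl⟩⟩
    · rintro h _ ⟨l, rfl⟩ x hx T hT hcard hm
      obtain ⟨h1, h2⟩ := h l x hx T hT hcard ((hspan l x T).1 hm)
      refine ⟨h1, ?_⟩
      rintro _ hk ⟨k, rfl⟩
      exact h2 k hk

theorem dual_edgeId_iff (M : SEMUR X H) (h : H) (x : X) :
    M.dual.EdgeId (Sum.inr x) (Sum.inl h) ↔ M.EdgeId h x := by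
  rw [SEMME.EdgeId, EdgeId]
  exact Iff.rfl

theorem mem_group_iff (M : SEMUR X H) {x : X} {v : H ⊕ X} :
    v ∈ M.group x ↔ v = Sum.inr x ∨ ∃ h, (M.B x h ≠ 0 ∧ ¬ M.EdgeId h x) ∧ Sum.inl h = v := by
  simp [group]

theorem dual_group (M : SEMUR X H) (x : X) : M.dual.group (Sum.inr x) = M.group x := by
  ext v
  rw [SEMME.mem_group_iff, mem_group_iff, dual_uLeaf_iff]
  refine or_congr_right ⟨?_, ?_⟩
  · rintro ⟨⟨h, rfl⟩, h1, h2⟩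
    exact ⟨h, ⟨h1, mt (M.dual_edgeId_iff h x).2 h2⟩, rfl⟩
  · rintro ⟨h, ⟨h1, h2⟩, rfl⟩
    exact ⟨⟨h, rfl⟩, h1, mt (M.dual_edgeId_iff h x).1 h2⟩

theorem mixing_eq (M : SEMUR X H) (x : X) (v : H ⊕ X) :
    M.mixing x v = (1 - M.dual.coef)⁻¹ v (Sum.inr x) := by
  have h1 : (1 - M.coef)⁻¹ =
      Matrix.fromBlocks 1 0 ((1 - M.A)⁻¹ * M.B) (1 - M.A)⁻¹ := by
    apply Matrix.inv_eq_right_inv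
    rw [coef, ← Matrix.fromBlocks_one, sub_eq_add_neg, Matrix.fromBlocks_neg,
      Matrix.fromBlocks_add, Matrix.fromBlocks_multiply]
    simp [← sub_eq_add_neg, ← Matrix.mul_assoc, Matrix.mul_nonsing_inv _ M.causalOrder.isUnit_det]
  have h2 : (1 - M.dual.coef)⁻¹ = ((1 - M.coef)⁻¹)ᵀ := by
    rw [Matrix.transpose_nonsing_inv, Matrix.transpose_sub, Matrix.transpose_one]
    rfl
  rw [h2, h1, Matrix.transpose_apply, mixing]
  rcases v with h | y <;> simp

theorem presents_dual (M : SEMUR X H) :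
    SEMME.Presents M.dual (fun v x => M.mixing x v) Sum.inr (fun _ => 1) fun _ => 1 := by
  refine ⟨Sum.inr_injective, fun v => ?_, by simp, by simp, fun v x => by simp [mixing_eq]⟩
  rw [SEMME.NULeaf, dual_uLeaf_iff]
  rcases v with h | x <;> simp

theorem dog_eq (M : SEMUR X H) : M.dog = M.dual.dog := by
  rw [M.presents_dual.dog_eq]
  ext G
  simp only [dog, Finset.mem_union, Finset.mem_image, Finset.mem_filter, Finset.mem_univ, true_and,
    dual_group]
  refine or_congr_right ⟨?_, ?_⟩
  · rintro ⟨h, hh, rfl⟩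
    refine ⟨Sum.inl h, fun x hx => ?_, rfl⟩
    rcases (M.mem_group_iff).1 hx with hx | ⟨k, ⟨h1, h2⟩, hk⟩
    · simp at hx
    · obtain rfl := Sum.inl_injective hk
      exact h2 (hh x h1)
  · rintro ⟨v, hv, rfl⟩
    rcases v with h | x
    · refine ⟨h, fun x hx => ?_, rfl⟩
      by_contra hn
      exact hv x ((M.mem_group_iff).2 (Or.inr ⟨h, ⟨hx, hn⟩, rfl⟩))
    · exact (hv x ((M.mem_group_iff).2 (Or.inl rfl))).elim

/-! ### Models with the same mixing matrix, up to the order of the latent variables -/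

/-- The rows of `M'` are those of `M`, after a renaming `e` of the variables and up to scaling. -/
theorem sameMixing_iff {M M' : SEMUR X H} :
    SameMixing M M' ↔ ∃ (e : Equiv.Perm (H ⊕ X)) (r : H ⊕ X → ℝ),
      SEMME.Presents M'.dual (fun v x => M.mixing x (e v)) Sum.inr r fun _ => 1 := by
  have h' := M'.presents_dual
  constructor
  · rintro ⟨e, t, ht, he⟩
    refine ⟨e, fun v => (t v)⁻¹, h'.inj, h'.range, fun v => inv_ne_zero (ht v), h'.col_ne,
      fun v x => ?_⟩
    rw [← mixing_eq, he, mul_one, inv_mul_cancel_left₀ (ht v)]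
  · rintro ⟨e, r, h⟩
    refine ⟨e, fun v => (r v)⁻¹, fun v => inv_ne_zero (h.row_ne v), fun x v => ?_⟩
    rw [h.apply_eq, mul_one, ← mixing_eq, inv_mul_cancel_left₀ (h.row_ne v)]

theorem mem_group_of_presents {M M' : SEMUR X H} (hM : M.Faithful) (hM' : M'.Faithful)
    {e : Equiv.Perm (H ⊕ X)} {r : H ⊕ X → ℝ} {t : X → ℝ}
    (h : SEMME.Presents M'.dual (fun v x => M.mixing x (e v)) Sum.inr r t) (x : X) :
    e (Sum.inr x) ∈ M.group x := by
  have h1 := h.rowFaithful (M'.dual_faithful_iff.2 hM')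
  have h2 := RowFaithful.relabel (R := fun v x => M.mixing x v) e h1
  rw [← dual_group]
  exact M.presents_dual.mem_group (M.dual_faithful_iff.2 hM) h2 x

/-- If the noise terms of the observed variables are attached to the same rows, then the two models
differ only in the order and the scaling of the latent variables. -/
theorem rel_of_presents {M M' M'' : SEMUR X H} {e' e'' : Equiv.Perm (H ⊕ X)} {r' r'' : H ⊕ X → ℝ}
    (h' : SEMME.Presents M'.dual (fun v x => M.mixing x (e' v)) Sum.inr r' fun _ => 1)
    (h'' : SEMME.Presents M''.dual (fun v x => M.mixing x (e'' v)) Sum.inr r'' fun _ => 1)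
    (he : ∀ x, e' (Sum.inr x) = e'' (Sum.inr x)) : (instSetoid X H).r M' M'' := by
  have hm' : ∀ x v, M.mixing x (e' v) = r' v * M'.mixing x v := fun x v => by
    rw [h'.apply_eq, mixing_eq, mul_one]
  have hm'' : ∀ x v, M.mixing x (e'' v) = r'' v * M''.mixing x v := fun x v => by
    rw [h''.apply_eq, mixing_eq, mul_one]
  have hr : ∀ y, r' (Sum.inr y) = r'' (Sum.inr y) := by
    intro y
    have h1 := hm' y (Sum.inr y)
    rw [he, hm'', mixing_apply_inr, mixing_apply_inr, M'.causalOrder.inv_apply_self,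
      M''.causalOrder.inv_apply_self, mul_one, mul_one] at h1
    exact h1.symm
  have hinv : (1 - M'.A)⁻¹ = (1 - M''.A)⁻¹ := by
    ext x y
    have h1 := hm' x (Sum.inr y)
    rw [he, hm'', hr] at h1
    exact (mul_left_cancel₀ (h''.row_ne _) h1).symm
  have hA : M''.A = M'.A :=
    (sub_right_injective (Matrix.inv_inj hinv M'.causalOrder.isUnit_det)).symm
  have hex : ∀ h, ∃ k, e'.symm (e'' (Sum.inl h)) = Sum.inl k := by
    intro h
    rcases hk : e'.symm (e'' (Sum.inl h)) with k | y
    · exact ⟨k, rfl⟩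
    · rw [Equiv.symm_apply_eq, he] at hk
      exact (Sum.inl_ne_inr (e''.injective hk)).elim
  choose f hf using hex
  have hfi : Function.Injective f := by
    intro h k hhk
    have h1 : e'.symm (e'' (Sum.inl h)) = e'.symm (e'' (Sum.inl k)) := by rw [hf, hf, hhk]
    exact Sum.inl_injective (e''.injective (e'.symm.injective h1))
  have hf' : ∀ h, e'' (Sum.inl h) = e' (Sum.inl (f h)) := fun h => by
    rw [← hf, Equiv.apply_symm_apply]
  refine ⟨hA, Equiv.ofBijective f (Finite.injective_iff_bijective.1 hfi),
    fun h => (r'' (Sum.inl h))⁻¹ * r' (Sum.inl (f h)),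
    fun h => mul_ne_zero (inv_ne_zero (h''.row_ne _)) (h'.row_ne _), fun x h => ?_⟩
  have hcol : ∀ y, ((1 - M'.A)⁻¹ * M''.B) y h =
      (r'' (Sum.inl h))⁻¹ * r' (Sum.inl (f h)) * ((1 - M'.A)⁻¹ * M'.B) y (f h) := by
    intro y
    rw [hinv, ← mixing_apply_inl, ← hinv, ← mixing_apply_inl, mul_assoc, ← hm', ← hf', hm'',
      inv_mul_cancel_left₀ (h''.row_ne _)]
  have hB : ∀ N : Matrix X H ℝ, N = (1 - M'.A) * ((1 - M'.A)⁻¹ * N) := fun N => by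
    rw [← Matrix.mul_assoc, Matrix.mul_nonsing_inv _ M'.causalOrder.isUnit_det, Matrix.one_mul]
  rw [hB M''.B, hB M'.B, Matrix.mul_apply]
  simp only [Equiv.ofBijective_apply]
  rw [Matrix.mul_apply, Finset.mul_sum]
  refine Finset.sum_congr rfl fun y _ => ?_
  rw [hcol]
  ring

/-- By separability, the matrix `A` shows which rows of `M` belong to the observed variables. -/
theorem eq_of_rel {M M' M'' : SEMUR X H} (hM : M.Separable) {e' e'' : Equiv.Perm (H ⊕ X)}
    {r' r'' : H ⊕ X → ℝ}
    (h' : SEMME.Presents M'.dual (fun v x => M.mixing x (e' v)) Sum.inr r' fun _ => 1)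
    (h'' : SEMME.Presents M''.dual (fun v x => M.mixing x (e'' v)) Sum.inr r'' fun _ => 1)
    (hrel : (instSetoid X H).r M' M'') (x : X) : e' (Sum.inr x) = e'' (Sum.inr x) := by
  by_contra hne
  have h1 := LinearIndependent.pair_iff.1 (hM _ _ hne) (r'' (Sum.inr x)) (-r' (Sum.inr x)) (by
    ext y
    have h2 := h'.apply_eq (Sum.inr x) y
    have h3 := h''.apply_eq (Sum.inr x) y
    rw [mul_one, ← mixing_eq, mixing_apply_inr] at h2 h3
    rw [hrel.1] at h3
    simp only [Pi.add_apply, Pi.smul_apply, smul_eq_mul, Pi.zero_apply, Matrix.col_apply]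
    rw [h2, h3]
    ring)
  exact h''.row_ne _ h1.1

theorem exists_choice {M : SEMUR X H} (hM : M.Faithful) {c : X → H ⊕ X}
    (hc : ∀ x, c x ∈ M.group x) :
    ∃ M' ∈ M.dogClass, ∃ (e : Equiv.Perm (H ⊕ X)) (r : H ⊕ X → ℝ), (∀ x, e (Sum.inr x) = c x) ∧
      SEMME.Presents M'.dual (fun v x => M.mixing x (e v)) Sum.inr r fun _ => 1 := by
  have h := M.presents_dual
  have hR := h.rowFaithful (M.dual_faithful_iff.2 hM)
  have hce : ∀ x, c x ≠ Sum.inr x → Exchangeable Sum.inr (M.dual.parentIdx Sum.inr) x (c x) :=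
    fun x hx => h.exchangeable_of_mem_group (by rw [dual_group]; exact hc x) hx
  obtain ⟨σ, hσ⟩ := hR.exists_isExchange hce
  have hR' : RowFaithful (fun v x => M.mixing x (σ v)) Sum.inr (M.dual.parentIdx Sum.inr) := by
    -- renaming the variables by `σ` restores the edges of the original diagram
    have h1 := RowFaithful.relabel (R := fun v x => M.mixing x (σ v)) σ.symm
      (ν := c) (p := fun v => M.dual.parentIdx Sum.inr (σ v))
      (by simpa using hR.exchange hce hσ)
    simpa [hσ.invol, ← hσ.node] using h1
  let r : H ⊕ X → ℝ := Sum.elim (fun _ => 1) fun x => M.mixing x (c x)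
  have hr : ∀ v, r v ≠ 0 := by
    rintro (k | x)
    · exact one_ne_zero
    · exact hR.diag_choice hce x
  obtain ⟨D, hobs, hp, hD⟩ := SEMME.exists_presents hR' (obs := Set.range Sum.inr) (by simp)
    (by simp) hr
  obtain ⟨M', rfl⟩ := exists_dual_eq hobs fun k => (hD.uLeaf_iff _).2 (by simp)
  have ht : (fun x => M.mixing x (σ (Sum.inr x)) / r (Sum.inr x)) = fun _ => (1 : ℝ) := by
    funext x
    have : M.mixing x (σ (Sum.inr x)) = r (Sum.inr x) := by rw [hσ.node]; rfl
    rw [this, div_self (hr _)]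
  rw [ht] at hD
  refine ⟨M', ⟨M'.dual_faithful_iff.1 (hD.faithful (hp ▸ hR')), sameMixing_iff.2 ⟨σ, r, hD⟩, ?_⟩,
    σ, r, hσ.node, hD⟩
  have hgroup : ∀ x, M'.dual.group (Sum.inr x) = M.dual.group (Sum.inr x) := by
    intro x
    ext v
    rw [hD.mem_group_node_iff, h.mem_group_node_iff, hp]
  rw [dog_eq, dog_eq, hD.dog_eq, h.dog_eq]
  simp only [hgroup]

open Classical in
/-- Each choice `c` of one member in the group of each observed variable belongs to a model in the
class. -/
theorem exists_model_of_choices {M : SEMUR X H} (hM : M.Faithful) :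
    ∃ F : (X → H ⊕ X) → SEMUR X H, ∀ c ∈ Fintype.piFinset M.group, F c ∈ M.dogClass ∧
      ∃ (e : Equiv.Perm (H ⊕ X)) (r : H ⊕ X → ℝ), (∀ x, e (Sum.inr x) = c x) ∧
        SEMME.Presents (F c).dual (fun v x => M.mixing x (e v)) Sum.inr r fun _ => 1 := by
  have hex : ∀ c : X → H ⊕ X, ∃ M' : SEMUR X H, c ∈ Fintype.piFinset M.group → M' ∈ M.dogClass ∧
      ∃ (e : Equiv.Perm (H ⊕ X)) (r : H ⊕ X → ℝ), (∀ x, e (Sum.inr x) = c x) ∧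
        SEMME.Presents M'.dual (fun v x => M.mixing x (e v)) Sum.inr r fun _ => 1 := by
    intro c
    by_cases hc : c ∈ Fintype.piFinset M.group
    · obtain ⟨M', h1, h2⟩ := exists_choice hM (Fintype.mem_piFinset.1 hc)
      exact ⟨M', fun _ => ⟨h1, h2⟩⟩
    · exact ⟨M, fun hc' => (hc hc').elim⟩
  choose F hF using hex
  exact ⟨F, hF⟩

open Classical in
theorem ncard_dogClass {M : SEMUR X H} (hs : M.Separable) (hM : M.Faithful) :
    (Quotient.mk (instSetoid X H) '' M.dogClass).ncard = ∏ G ∈ M.dog, G.card := by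
  obtain ⟨F, hF⟩ := exists_model_of_choices hM
  have himg : Quotient.mk (instSetoid X H) '' M.dogClass =
      (fun c => Quotient.mk (instSetoid X H) (F c)) '' (Fintype.piFinset M.group : Set _) := by
    ext q
    constructor
    · rintro ⟨M', ⟨h1, h2, -⟩, rfl⟩
      obtain ⟨e, r, h⟩ := sameMixing_iff.1 h2
      have hc : (fun x => e (Sum.inr x)) ∈ Fintype.piFinset M.group :=
        Fintype.mem_piFinset.2 (mem_group_of_presents hM h1 h)
      obtain ⟨-, e', r', he', h'⟩ := hF _ hc
      exact ⟨_, hc, Quotient.sound (rel_of_presents h' h he')⟩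
    · rintro ⟨c, hc, rfl⟩
      exact ⟨F c, (hF c hc).1, rfl⟩
  have hinj : Set.InjOn (fun c => Quotient.mk (instSetoid X H) (F c))
      (Fintype.piFinset M.group : Set _) := by
    intro c hc c' hc' he
    obtain ⟨-, e, r, h1, h2⟩ := hF c hc
    obtain ⟨-, e', r', h1', h2'⟩ := hF c' hc'
    funext x
    rw [← h1, ← h1', eq_of_rel hs h2 h2' (Quotient.exact he)]
  rw [himg, hinj.ncard_image, Set.ncard_coe_finset, Fintype.card_piFinset, dog_eq,
    M.presents_dual.prod_dog (M.dual_faithful_iff.2 hM) Finset.card_singleton]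
  simp only [dual_group]

theorem identifiable_iff {M : SEMUR X H} (hs : M.Separable) (hM : M.Faithful) :
    M.Identifiable ↔ ∀ h x, M.B x h ≠ 0 → M.EdgeId h x := by
  have hself : ∀ x, Sum.inr x ∈ M.group x := fun x => (M.mem_group_iff).2 (Or.inl rfl)
  constructor
  · intro hI k x hk
    by_contra hn
    -- the models for two different choices would both be equivalent to `M`
    have hc : ∀ y, Function.update (Sum.inr : X → H ⊕ X) x (Sum.inl k) y ∈ M.group y := by
      intro y
      by_cases hy : y = x
      · subst hy
        simpa using (M.mem_group_iff).2 (Or.inr ⟨k, ⟨hk, hn⟩, rfl⟩)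
      · simpa [hy] using hself y
    obtain ⟨M₁, h1, e₁, r₁, he₁, hp₁⟩ := exists_choice hM hself
    obtain ⟨M₂, h2, e₂, r₂, he₂, hp₂⟩ := exists_choice hM hc
    have hrel : (instSetoid X H).r M₁ M₂ :=
      (instSetoid X H).trans ((instSetoid X H).symm (hI _ h1.1 h1.2.1)) (hI _ h2.1 h2.2.1)
    have h3 := eq_of_rel hs hp₁ hp₂ hrel x
    rw [he₁, he₂] at h3
    simp at h3
  · intro hid M' hM' hmix
    obtain ⟨e, r, h⟩ := sameMixing_iff.1 hmix
    refine rel_of_presents (M := M) (e' := Equiv.refl _) M.presents_dual h fun x => ?_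
    rcases (M.mem_group_iff).1 (mem_group_of_presents hM hM' h x) with hx | ⟨k, ⟨h1, h2⟩, -⟩
    · exact hx.symm
    · exact (h2 (hid k x h1)).elim

end SEMUR

theorem mainTheorem6 {V X H : Type*} [Fintype V] [DecidableEq V]
    [Fintype X] [DecidableEq X] [Fintype H] [DecidableEq H] :
    (∀ M : SEMME V, M.Faithful →
      (SEMME.coef '' M.dogClass).ncard = ∏ G ∈ M.dog, G.card ∧
      (M.UniquelyIdentifiable ↔
        ∀ v l, M.NULeaf v → M.ULeaf l → Diagram.Edge M.coef v l → M.EdgeId v l) ∧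
      (∀ D : Finset (Finset V),
        (∀ G, G ∈ D ↔ G ∈ M.dog ∧ ∀ v ∈ G, v ∉ M.observed) →
        {M' ∈ M.dogClass | M'.observed = M.observed}.ncard = ∏ G ∈ D, G.card) ∧
      (M.UniquelyIdentifiableKnownObs ↔
        ∀ v l, M.NULeaf v → v ∉ M.observed → M.ULeaf l → Diagram.Edge M.coef v l →
          M.EdgeId v l)) ∧
    (∀ M : SEMUR X H, M.Separable → M.Faithful →
      (Quotient.mk (SEMUR.instSetoid X H) '' M.dogClass).ncard = ∏ G ∈ M.dog, G.card ∧
      (M.Identifiable ↔ ∀ h x, M.B x h ≠ 0 → M.EdgeId h x)) :=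
  ⟨fun _ hM => ⟨SEMME.ncard_coef_dogClass hM, SEMME.uniquelyIdentifiable_iff hM,
      fun _ hD => SEMME.ncard_dogClass_observed hM hD,
      SEMME.uniquelyIdentifiableKnownObs_iff hM⟩,
    fun _ hs hM => ⟨SEMUR.ncard_dogClass hs hM, SEMUR.identifiable_iff hs hM⟩⟩
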